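/- Conventions. Manifolds are compact, unoriented and piecewise linear (PL), possibly with boundary, and homeomorphisms are PL. Let $K$ be a field and $n\ge 0$. An $n$-dimensional system of fields $\mathcal F$ enriched over $K$-vector spaces consists of: for every $k\le n$ and every $k$-manifold $X$ a set $\mathcal F(X)$ of fields, functorial for homeomorphisms; natural restriction maps $\mathcal F(X)\to\mathcal F(\partial X)$, where for $\dim X=n$ each fibre $\mathcal F(X;c)$ over $c\in\mathcal F(\partial X)$ is a $K$-vector space on which the structure maps act linearly; compatibility with disjoint unions ($\mathcal F(X\sqcup W)\cong\mathcal F(X)\times\mathcal F(W)$ in dimension $<n$, and $\mathcal F(X\sqcup W;c\sqcup d)\cong\mathcal F(X;c)\otimes\mathcal F(W;d)$ in dimension $n$); gluing maps, with or without corners, from the fields on $X$ whose restrictions to two disjoint copies of $Y$ in $\partial X$ exist and agree, to the fields on the manifold $X_{\mathrm{gl}}$ glued along $Y$, which are strictly associative, compatible with all of the above, injective (in dimension $n$: on fields with a fixed boundary condition), and surjective up to collar maps and homeomorphisms isotopic to the identity (in dimension $n$: up to linear combinations); splittings of every field along arbitrarily small perturbations of any cut (in dimension $n$: up to linear combinations);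 and product fields $\mathcal F(Y)\to\mathcal F(Y\times I)$ compatible with all of this. For a gluing of two pieces write $u\bullet r$ for the glued field. A local relation $U$ is a choice of subspaces $U(B;c)\subseteq\mathcal F(B;c)$ for all $n$-balls $B$ and $c\in\mathcal F(\partial B)$ which is preserved by homeomorphisms, contains $x-y$ whenever $x,y\in\mathcal F(B;c)$ are extended isotopic (related by collar maps and homeomorphisms isotopic to the identity rel boundary), and is an ideal: if $B=B'\cup B''$ with $B,B'$ balls, $x\in U(B')$ and $r\in\mathcal F(B'')$, then $x\bullet r\in U(B)$. Let $X$ be an $n$-manifold and $c\in\mathcal F(\partial X)$ a boundary condition (no condition if $X$ is closed). A blob in $X$ is an embedded closed $n$-ball $B\subseteq X$ such that $X\setminus B$ (meaning its closure) is a manifold and $X$ is obtained by gluing $B$ and $X\setminus B$ along their intersection. Let $U(X;c)\subseteq\mathcal F(X;c)$ be the span of all fields $u\bullet r\in\mathcal F(X;c)$ with $B$ a blob in $X$, $u\in U(B)$ and $r\in\mathcal F(X\setminus B)$, and let $A(X;c)=\mathcal F(X;c)/U(X;c)$ be the skein module. Let $\mathcal B_0(X;c)=\mathcal F(X;c)$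 and $$\mathcal B_1(X;c)=\bigoplus_{B}\ \bigoplus_{(b,s)}U(B;b)\otimes\mathcal F(X\setminus B;s),\qquad \partial(u\otimes r)=u\bullet r,$$ where $B$ runs over the blobs in $X$, and $(b,s)$ over the pairs of boundary conditions $b\in\mathcal F(\partial B)$, $s\in\mathcal F(\partial(X\setminus B))$ which agree on $B\cap (X\setminus B)$ and with $c$ on $\partial X$ (if $X$ is closed, then $b=s$). **Proposition.** The 0-th blob homology $H_0(\mathcal B_*(X;c))=\mathcal B_0(X;c)/\partial\mathcal B_1(X;c)$ is naturally isomorphic to the skein module $A(X;c)$: there are $K$-linear isomorphisms $\Phi_{X,c}:H_0(\mathcal B_*(X;c))\to A(X;c)$ sending the class of each field $x$ to the class of $x$; and for every homeomorphism $f:X\to X'$ the map $f:\mathcal F(X;c)\to\mathcal F(X';f(c))$ induces linear maps on both sides, which commute with $\Phi$. -/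

import Mathlib

open Set Topology

/-! ### Piecewise linear topology inside `ℝ^∞` -/

namespace BlobComplex

/-- The ambient space in which all polyhedra live.  Every compact polyhedron embeds in it. -/
abbrev V : Type := ℕ → ℝ

/-- A convex polyhedral cell: the points of an affine subspace which satisfy finitely many
affine inequalities. -/
def IsCell (K : Set V) : Prop :=
  ∃ (S : AffineSubspace ℝ V) (T : Set (V →ᵃ[ℝ] ℝ)), T.Finite ∧ K = {x | x ∈ S ∧ ∀ a ∈ T, 0 ≤ a x}

/-- A compact polyhedron: a compact set which is a finite union of cells. -/
def IsPolyhedron (X : Set V) : Prop :=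
  IsCompact X ∧ ∃ 𝒦 : Set (Set V), 𝒦.Finite ∧ (∀ K ∈ 𝒦, IsCell K) ∧ X = ⋃₀ 𝒦

/-- A map is piecewise linear if finitely many cells cover its domain such that the map is affine
on each of them. -/
def IsPL {A B : Set V} (f : A → B) : Prop :=
  ∃ (ι : Type) (_ : Finite ι) (K : ι → Set V) (a : ι → (V →ᵃ[ℝ] V)),
    (∀ i, IsCell (K i)) ∧ (∀ x : A, ∃ i, (x : V) ∈ K i) ∧
      ∀ i (x : A), (x : V) ∈ K i → (f x : V) = a i x

/-- Piecewise linear homeomorphisms. -/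
structure PLHomeo (A B : Set V) extends A ≃ₜ B where
  isPL : IsPL toFun
  isPL_inv : IsPL invFun

instance {A B : Set V} : CoeFun (PLHomeo A B) (fun _ => A → B) := ⟨fun f => f.toFun⟩

theorem isCell_univ : IsCell univ := ⟨⊤, ∅, finite_empty, by ext; simp⟩

theorem IsCell.inter_preimage {K L : Set V} (hK : IsCell K) (hL : IsCell L) (a : V →ᵃ[ℝ] V) :
    IsCell (K ∩ a ⁻¹' L) := by
  obtain ⟨S, T, hT, rfl⟩ := hK
  obtain ⟨S', T', hT', rfl⟩ := hL
  refine ⟨S ⊓ S'.comap a, T ∪ (fun b : V →ᵃ[ℝ] ℝ => b.comp a) '' T', hT.union (hT'.image _), ?_⟩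
  ext x
  simp only [mem_inter_iff, mem_ofPred_eq, mem_preimage, AffineSubspace.mem_inf_iff,
    AffineSubspace.mem_comap, mem_union, mem_image]
  constructor
  · rintro ⟨⟨h1, h2⟩, h3, h4⟩
    refine ⟨⟨h1, h3⟩, ?_⟩
    rintro b (hb | ⟨b', hb', rfl⟩)
    · exact h2 b hb
    · exact h4 b' hb'
  · rintro ⟨⟨h1, h3⟩, h⟩
    exact ⟨⟨h1, fun b hb => h b (Or.inl hb)⟩, h3, fun b hb => h _ (Or.inr ⟨b, hb, rfl⟩)⟩

theorem IsPL.id (A : Set V) : IsPL (fun x : A => x) :=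
  ⟨Unit, inferInstance, fun _ => univ, fun _ => AffineMap.id ℝ V, fun _ => isCell_univ,
    fun _ => ⟨(), trivial⟩, fun _ _ _ => rfl⟩

theorem IsPL.comp {A B C : Set V} {g : B → C} {f : A → B} (hg : IsPL g) (hf : IsPL f) :
    IsPL (fun x => g (f x)) := by
  obtain ⟨ι, _, K, a, hK, hc, ha⟩ := hf
  obtain ⟨κ, _, L, b, hL, hc', hb⟩ := hg
  refine ⟨ι × κ, inferInstance, fun p => K p.1 ∩ a p.1 ⁻¹' L p.2, fun p => (b p.2).comp (a p.1),
    fun p => (hK p.1).inter_preimage (hL p.2) _, fun x => ?_, ?_⟩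
  · obtain ⟨i, hi⟩ := hc x
    obtain ⟨j, hj⟩ := hc' (f x)
    exact ⟨(i, j), hi, by rw [mem_preimage, ← ha i x hi]; exact hj⟩
  · rintro ⟨i, j⟩ x ⟨hi, hj⟩
    rw [mem_preimage, ← ha i x hi] at hj
    rw [hb j _ hj, ha i x hi]
    rfl

/-- Restricting source and target of a piecewise linear map. -/
theorem IsPL.restrict {A B A' B' : Set V} {f : A → B} (hf : IsPL f) (hA : A' ⊆ A) {g : A' → B'}
    (h : ∀ x : A', (g x : V) = f ⟨x, hA x.2⟩) : IsPL g := by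
  obtain ⟨ι, hι, K, a, hK, hc, ha⟩ := hf
  exact ⟨ι, hι, K, a, hK, fun x => hc ⟨x, hA x.2⟩, fun i x hx => by rw [h, ha i _ hx]⟩

namespace PLHomeo

variable {A B C : Set V}

def refl (A : Set V) : PLHomeo A A := ⟨Homeomorph.refl A, IsPL.id A, IsPL.id A⟩

def symm (f : PLHomeo A B) : PLHomeo B A := ⟨f.toHomeomorph.symm, f.isPL_inv, f.isPL⟩

def trans (f : PLHomeo A B) (g : PLHomeo B C) : PLHomeo A C :=
  ⟨f.toHomeomorph.trans g.toHomeomorph, g.isPL.comp f.isPL, f.isPL_inv.comp g.isPL_inv⟩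

theorem symm_apply_apply (f : PLHomeo A B) (x : A) : f.symm (f x) = x := f.left_inv x

theorem apply_symm_apply (f : PLHomeo A B) (y : B) : f (f.symm y) = y := f.right_inv y

/-- The restriction of a homeomorphism to subsets which correspond under it. -/
def restrict (f : PLHomeo A B) {A' B' : Set V} (hA : A' ⊆ A) (hB : B' ⊆ B)
    (h : ∀ x : A, (x : V) ∈ A' ↔ (f x : V) ∈ B') : PLHomeo A' B' where
  toFun x := ⟨f ⟨x, hA x.2⟩, (h _).1 x.2⟩
  invFun y := ⟨f.symm ⟨y, hB y.2⟩, (h _).2 (by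
    rw [f.apply_symm_apply]; exact y.2)⟩
  left_inv x := by
    have h := congrArg Subtype.val (f.symm_apply_apply ⟨x, hA x.2⟩)
    exact Subtype.ext h
  right_inv y := by
    have h := congrArg Subtype.val (f.apply_symm_apply ⟨y, hB y.2⟩)
    exact Subtype.ext h
  continuous_toFun := by
    refine Continuous.subtype_mk (continuous_subtype_val.comp (f.continuous_toFun.comp ?_)) _
    exact Continuous.subtype_mk continuous_subtype_val _
  continuous_invFun := by
    refine Continuous.subtype_mk (continuous_subtype_val.comp (f.continuous_invFun.comp ?_)) _
    exact Continuous.subtype_mk continuous_subtype_val _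
  isPL := f.isPL.restrict hA (fun _ => rfl)
  isPL_inv := f.isPL_inv.restrict hB (fun _ => rfl)

end PLHomeo

/-! ### Manifolds -/

/-- The standard `m`-cube `[0,1]^m`. -/
def cube (m : ℕ) : Set V := {x | (∀ i < m, 0 ≤ x i ∧ x i ≤ 1) ∧ ∀ i, m ≤ i → x i = 0}

/-- The interior of the standard `m`-cube, as a subset of `ℝ^m`. -/
def openCube (m : ℕ) : Set V := {x ∈ cube m | ∀ i < m, 0 < x i ∧ x i < 1}

/-- `Q` is a `d`-ball. (There are none in negative dimensions.) -/
def IsBall (d : ℤ) (Q : Set V) : Prop := ∃ m : ℕ, (m : ℤ) = d ∧ Nonempty (PLHomeo Q (cube m))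

/-- Every point of `X` has a neighbourhood in `X` which is a `d`-ball. -/
def IsLocallyBall (d : ℤ) (X : Set V) : Prop :=
  ∀ x ∈ X, ∃ Q ⊆ X, Q ∈ 𝓝[X] x ∧ IsBall d Q

/-- `x` is an interior point of the `d`-manifold `X`: it has arbitrarily small neighbourhoods in `X`
which are `d`-balls with `x` in their interior. -/
def IsInteriorPt (d : ℤ) (X : Set V) (x : V) : Prop :=
  ∀ O ∈ 𝓝 x, ∃ Q ⊆ O ∩ X, Q ∈ 𝓝[X] x ∧ ∃ (m : ℕ) (_ : (m : ℤ) = d) (φ : PLHomeo Q (cube m))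
    (hx : x ∈ Q), (φ ⟨x, hx⟩ : V) ∈ openCube m

/-- The boundary of a `d`-manifold. -/
def boundarySet (d : ℤ) (X : Set V) : Set V := {x ∈ X | ¬ IsInteriorPt d X x}

theorem boundarySet_subset (d : ℤ) (X : Set V) : boundarySet d X ⊆ X := fun _ h => h.1

/-- A compact PL manifold of dimension `d`, possibly with boundary.  The empty set is a manifold of
every dimension and the only one of negative dimension.  The last two fields follow from the
others (the boundary of a manifold is a closed manifold); they are recorded so that the boundary
is available as a manifold without invariance of domain. -/
@[ext]
structure PLMan (d : ℤ) where
  carrier : Set V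
  isPolyhedron : IsPolyhedron carrier
  locallyBall : IsLocallyBall d carrier
  boundary_isPolyhedron : IsPolyhedron (boundarySet d carrier)
  boundary_locallyBall : IsLocallyBall (d - 1) (boundarySet d carrier)
  boundary_boundary : boundarySet (d - 1) (boundarySet d carrier) = ∅

theorem isPolyhedron_empty : IsPolyhedron ∅ :=
  ⟨isCompact_empty, ∅, finite_empty, by simp, by simp⟩

theorem boundarySet_empty (d : ℤ) : boundarySet d ∅ = ∅ := by
  ext x; simp [boundarySet]

instance {d : ℤ} : CoeSort (PLMan d) Type := ⟨fun X => X.carrier⟩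

/-- The boundary of a manifold, as a manifold of one dimension less. -/
def PLMan.bdry {d : ℤ} (X : PLMan d) : PLMan (d - 1) where
  carrier := boundarySet d X.carrier
  isPolyhedron := X.boundary_isPolyhedron
  locallyBall := X.boundary_locallyBall
  boundary_isPolyhedron := by rw [X.boundary_boundary]; exact isPolyhedron_empty
  boundary_locallyBall := by rw [X.boundary_boundary]; exact fun x hx => hx.elim
  boundary_boundary := by rw [X.boundary_boundary]; exact boundarySet_empty _

/-- Homeomorphisms of manifolds are piecewise linear. -/
abbrev PLMan.Iso {d : ℤ} (X Y : PLMan d) : Type := PLHomeo X.carrier Y.carrier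

theorem IsInteriorPt.map {d : ℤ} {X Y : Set V} (f : PLHomeo X Y) (x : X)
    (h : IsInteriorPt d X x) : IsInteriorPt d Y (f x) := by
  intro O hO
  have h1 : (fun z : X => (f z : V)) ⁻¹' O ∈ 𝓝 x :=
    (continuous_subtype_val.comp f.continuous_toFun).continuousAt hO
  obtain ⟨O', hO', hsub⟩ := (mem_nhds_subtype X x _).1 h1
  obtain ⟨Q, hQ, hQn, m, hm, φ, hx, hφ⟩ := h O' hO'
  have hQX : Q ⊆ X := fun z hz => (hQ hz).2
  let Q' : Set V := {y | ∃ hy : y ∈ Y, (f.symm ⟨y, hy⟩ : V) ∈ Q}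
  have hQ'Y : Q' ⊆ Y := fun y hy => hy.1
  have key : ∀ z : X, (z : V) ∈ Q ↔ (f z : V) ∈ Q' := by
    intro z
    constructor
    · intro hz; exact ⟨(f z).2, by rw [f.symm_apply_apply]; exact hz⟩
    · rintro ⟨h1, h2⟩; rwa [f.symm_apply_apply] at h2
  let g : PLHomeo Q Q' := f.restrict hQX hQ'Y key
  refine ⟨Q', ?_, ?_, m, hm, g.symm.trans φ, (key x).1 hx, ?_⟩
  · rintro y ⟨hy, hyQ⟩
    refine ⟨?_, hy⟩
    have h2 := hsub (show f.symm ⟨y, hy⟩ ∈ Subtype.val ⁻¹' O' from (hQ hyQ).1)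
    rwa [mem_preimage, f.apply_symm_apply] at h2
  · have h2 : (Subtype.val ⁻¹' Q : Set X) ∈ 𝓝 x := by
      rw [mem_nhds_subtype_iff_nhdsWithin]
      exact Filter.mem_of_superset hQn (fun z hz => ⟨⟨z, hQX hz⟩, hz, rfl⟩)
    have h3 : (fun y : Y => f.symm y) ⁻¹' (Subtype.val ⁻¹' Q) ∈ 𝓝 (f x) := by
      have hc : ContinuousAt (fun y : Y => f.symm y) (f x) :=
        (f.continuous_invFun).continuousAt
      exact hc.preimage_mem_nhds (by rw [f.symm_apply_apply]; exact h2)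
    rw [mem_nhds_subtype_iff_nhdsWithin] at h3
    refine Filter.mem_of_superset h3 ?_
    rintro _ ⟨y, hy, rfl⟩
    exact ⟨y.2, hy⟩
  · have h4 : g.symm ⟨(f x : V), (key x).1 hx⟩ = ⟨(x : V), hx⟩ := g.left_inv ⟨(x : V), hx⟩
    change (φ (g.symm ⟨(f x : V), _⟩) : V) ∈ openCube m
    rw [h4]; exact hφ

theorem mem_boundarySet_map {d : ℤ} {X Y : Set V} (f : PLHomeo X Y) (x : X) :
    (x : V) ∈ boundarySet d X ↔ (f x : V) ∈ boundarySet d Y := by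
  have h : IsInteriorPt d X x ↔ IsInteriorPt d Y (f x) := by
    refine ⟨fun h => h.map f x, fun h => ?_⟩
    have := h.map f.symm (f x)
    rwa [f.symm_apply_apply] at this
  simp [boundarySet, h]

/-- The homeomorphism of boundaries induced by a homeomorphism. -/
def PLHomeo.bdry {d : ℤ} {X Y : PLMan d} (f : X.Iso Y) : X.bdry.Iso Y.bdry :=
  PLHomeo.restrict f (boundarySet_subset d X.carrier) (boundarySet_subset d Y.carrier)
    (mem_boundarySet_map f)

/-- `M` is the disjoint union of `A` and `B`. -/
structure DisjUnion {d : ℤ} (M A B : PLMan d) : Prop where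
  union : A.carrier ∪ B.carrier = M.carrier
  disjoint : Disjoint A.carrier B.carrier

theorem isInteriorPt_congr {d : ℤ} {X X' O : Set V} {x : V} (hO : O ∈ 𝓝 x)
    (h : X ∩ O = X' ∩ O) (hX : IsInteriorPt d X x) : IsInteriorPt d X' x := by
  intro O' hO'
  obtain ⟨Q, hQ, hQn, rest⟩ := hX (O' ∩ O) (Filter.inter_mem hO' hO)
  refine ⟨Q, fun z hz => ⟨(hQ hz).1.1, ?_⟩, ?_, rest⟩
  · have : z ∈ X ∩ O := ⟨(hQ hz).2, (hQ hz).1.2⟩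
    rw [h] at this; exact this.1
  · rwa [← nhdsWithin_eq_nhdsWithin' hO h]

theorem DisjUnion.symm {d : ℤ} {M A B : PLMan d} (h : DisjUnion M A B) : DisjUnion M B A :=
  ⟨by rw [union_comm]; exact h.union, h.disjoint.symm⟩

theorem DisjUnion.mem_boundary {d : ℤ} {M A B : PLMan d} (h : DisjUnion M A B) {x : V}
    (hx : x ∈ A.carrier) : x ∈ boundarySet d A.carrier ↔ x ∈ boundarySet d M.carrier := by
  have hO : (B.carrier)ᶜ ∈ 𝓝 x :=
    B.isPolyhedron.1.isClosed.isOpen_compl.mem_nhds (disjoint_left.1 h.disjoint hx)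
  have hAM : A.carrier ∩ (B.carrier)ᶜ = M.carrier ∩ (B.carrier)ᶜ := by
    rw [← h.union]; ext z; simp; tauto
  have hxM : x ∈ M.carrier := by rw [← h.union]; exact Or.inl hx
  have : IsInteriorPt d A.carrier x ↔ IsInteriorPt d M.carrier x :=
    ⟨isInteriorPt_congr hO hAM, isInteriorPt_congr hO hAM.symm⟩
  simp [boundarySet, hx, hxM, this]

/-- The boundary of a disjoint union is the disjoint union of the boundaries. -/
theorem DisjUnion.bdry {d : ℤ} {M A B : PLMan d} (h : DisjUnion M A B) :
    DisjUnion M.bdry A.bdry B.bdry where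
  union := by
    ext x
    change x ∈ boundarySet d A.carrier ∪ boundarySet d B.carrier ↔ x ∈ boundarySet d M.carrier
    constructor
    · rintro (hx | hx)
      · exact (h.mem_boundary hx.1).1 hx
      · exact (h.symm.mem_boundary hx.1).1 hx
    · intro hx
      have : x ∈ A.carrier ∪ B.carrier := by rw [h.union]; exact hx.1
      rcases this with hA | hB
      · exact Or.inl ((h.mem_boundary hA).2 hx)
      · exact Or.inr ((h.symm.mem_boundary hB).2 hx)
  disjoint := h.disjoint.mono (boundarySet_subset _ _) (boundarySet_subset _ _)


/-! ### Gluing -/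

/-- A gluing of the `d`-manifold `X`, giving the `d`-manifold `Z`.  Here `Y₁` and `Y₂` are disjoint
codimension zero submanifolds of `∂X`, identified by the homeomorphism `h`, the remaining part of
`∂X` is `W`, with `∂W = ∂Y₁ ∪ ∂Y₂`, and `q : X → Z` is the quotient map which identifies each point
of `Y₁` with its image under `h`.  There are no corners precisely if `∂Y₁ = ∂Y₂ = ∅`. -/
structure Gluing {d : ℤ} (X Z : PLMan d) (Y₁ Y₂ W : PLMan (d - 1)) where
  h : Y₁.Iso Y₂
  q : X → Z
  subset₁ : Y₁.carrier ⊆ X.bdry.carrier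
  subset₂ : Y₂.carrier ⊆ X.bdry.carrier
  disjoint : Disjoint Y₁.carrier Y₂.carrier
  rest : W.carrier = closure (X.bdry.carrier \ (Y₁.carrier ∪ Y₂.carrier))
  corner : W.carrier ∩ (Y₁.carrier ∪ Y₂.carrier) = Y₁.bdry.carrier ∪ Y₂.bdry.carrier
  bdry_rest : W.bdry.carrier = Y₁.bdry.carrier ∪ Y₂.bdry.carrier
  continuous_q : Continuous q
  isPL_q : IsPL q
  surjective_q : Function.Surjective q
  q_eq_iff : ∀ x x' : X, q x = q x' ↔ x = x' ∨
    (∃ y : Y₁, (x : V) = y ∧ (x' : V) = h y) ∨ ∃ y : Y₁, (x' : V) = y ∧ (x : V) = h y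

/-- If `X` is glued along `Y₁`, `Y₂` to give `Z`, then the rest `W` of `∂X` is glued along `∂Y₁`,
`∂Y₂` to give `∂Z`.  This says that `G'` is the induced gluing of boundaries. -/
def Gluing.IsBoundary {d : ℤ} {X Z : PLMan d} {Y₁ Y₂ W : PLMan (d - 1)} (G : Gluing X Z Y₁ Y₂ W)
    {E : PLMan (d - 1 - 1)} (G' : Gluing W Z.bdry Y₁.bdry Y₂.bdry E) : Prop :=
  E.carrier = ∅ ∧ ∀ (x : X) (w : W), (x : V) = w → (G.q x : V) = G'.q w

/-- A gluing decomposition: a finite sequence of gluings. -/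
inductive GluingSeq {d : ℤ} : PLMan d → PLMan d → Type
  | nil (X : PLMan d) : GluingSeq X X
  | cons {X Z T : PLMan d} {Y₁ Y₂ W : PLMan (d - 1)} (G : Gluing X Z Y₁ Y₂ W)
      (S : GluingSeq Z T) : GluingSeq X T

/-- The composite quotient map of a sequence of gluings. -/
def GluingSeq.quot {d : ℤ} {X T : PLMan d} : GluingSeq X T → X → T
  | .nil _ => id
  | .cons G S => fun x => S.quot (G.q x)

/-- A presentation of `M` as the union of submanifolds `A₁`, `A₂`, `A₃` of codimension zero, where
`A₁` and `A₂` are disjoint and `A₁ ∪ A₂` is glued to `A₃` along the whole boundaries: a disjoint union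
`D = (D₁ ⊔ D₂) ⊔ D₃` of copies of the `Aᵢ`, and a gluing of `D` to `M` which is the tautological
map on each of the pieces. -/
structure Cut {d : ℤ} (M A₁ A₂ A₃ : PLMan d) where
  (D D₁₂ D₁ D₂ D₃ : PLMan d)
  disj₁₂ : DisjUnion D₁₂ D₁ D₂
  disj : DisjUnion D D₁₂ D₃
  α₁ : D₁.Iso A₁
  α₂ : D₂.Iso A₂
  α₃ : D₃.Iso A₃
  E : PLMan (d - 1)
  E_empty : E.carrier = ∅
  G : Gluing D M D₁₂.bdry D₃.bdry E
  q_eq₁ : ∀ (x : D) (y : D₁), (x : V) = y → (G.q x : V) = α₁ y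
  q_eq₂ : ∀ (x : D) (y : D₂), (x : V) = y → (G.q x : V) = α₂ y
  q_eq₃ : ∀ (x : D) (y : D₃), (x : V) = y → (G.q x : V) = α₃ y

/-- A presentation of `X` as the result of gluing its codimension zero submanifolds `A` and `R`
along `A ∩ R`: a disjoint union `D = A' ⊔ R'` of copies of `A` and `R`, and a gluing of `D` to `X`,
identifying a part of `∂A'` with a part of `∂R'`, which is the tautological map on `A'` and `R'`. -/
structure TwoPiece {d : ℤ} (X A R : PLMan d) where
  (D A' R' : PLMan d)
  disj : DisjUnion D A' R'
  α : A'.Iso A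
  ρ : R'.Iso R
  (Y₁ Y₂ W : PLMan (d - 1))
  G : Gluing D X Y₁ Y₂ W
  subset_A' : Y₁.carrier ⊆ A'.carrier
  subset_R' : Y₂.carrier ⊆ R'.carrier
  q_eq_α : ∀ (x : D) (y : A'), (x : V) = y → (G.q x : V) = α y
  q_eq_ρ : ∀ (x : D) (y : R'), (x : V) = y → (G.q x : V) = ρ y

/-- The point `(t, y)` of `ℝ × ℝ^∞ = ℝ^∞`. -/
def cons (t : ℝ) (y : V) : V := fun i => Nat.casesOn i t y

/-- The projection `(t, y) ↦ y`. -/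
def tail (v : V) : V := fun i => v (i + 1)

/-- The product `J × Y`, for `J ⊆ ℝ`. -/
def prodSet (J : Set ℝ) (Y : Set V) : Set V := {v | v 0 ∈ J ∧ tail v ∈ Y}

/-- `P`, with the coordinates `θ`, is the product `Y × I`, where `I = [0,1]`. -/
abbrev Cylinder {d : ℤ} (Y : PLMan (d - 1)) (P : PLMan d) : Type :=
  PLHomeo P.carrier (prodSet (Icc 0 1) Y.carrier)

/-- The homeomorphism `f : M → M` is isotopic to the identity. If `rel` holds, then the isotopy is
required to be fixed on `∂M`. -/
def IsotopicToId {d : ℤ} {M : PLMan d} (rel : Prop) (f : M.Iso M) : Prop :=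
  ∃ H : PLHomeo (prodSet (Icc 0 1) M.carrier) (prodSet (Icc 0 1) M.carrier),
    (∀ v : prodSet (Icc 0 1) M.carrier, (H v : V) 0 = (v : V) 0) ∧
    (∀ v : prodSet (Icc 0 1) M.carrier, (v : V) 0 = 0 → H v = v) ∧
    (∀ (v : prodSet (Icc 0 1) M.carrier) (m : M), (v : V) = cons 1 m → (H v : V) = cons 1 (f m)) ∧
    (rel → ∀ v : prodSet (Icc 0 1) M.carrier, tail v ∈ M.bdry.carrier → H v = v)

/-- A collar for `M`: the product `P = Y × I` is attached to `M` along a codimension zero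
submanifold `Y` of `∂M`, corresponding to `Y × {0} ⊆ P`, and `f : M ∪ (Y × I) → M` is a collaring
homeomorphism: the product structure extends to a bicollar neighbourhood `b : Y × [-1,1] → M ∪ P` of
`Y`, and `f` preserves the fibres of the bicollar and is the identity outside of it. -/
structure Collar {d : ℤ} (M : PLMan d) where
  (Y : PLMan (d - 1))
  (P T : PLMan d)
  θ : Cylinder Y P
  glue : TwoPiece T M P
  subset : Y.carrier ⊆ M.bdry.carrier
  inter : M.carrier ∩ P.carrier = Y.carrier
  θ_Y : ∀ (p : P) (y : Y), (p : V) = y → (θ p : V) = cons 0 y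
  N : Set V
  N_subset : N ⊆ T.carrier
  N_nhds : ∀ y ∈ Y.carrier, N ∈ 𝓝[T.carrier] y
  b : PLHomeo (prodSet (Icc (-1) 1) Y.carrier) N
  b_pos : ∀ (v : prodSet (Icc (-1) 1) Y.carrier) (p : P), (v : V) = θ p → (b v : V) = p
  b_neg : ∀ v : prodSet (Icc (-1) 1) Y.carrier, (v : V) 0 ≤ 0 → (b v : V) ∈ M.carrier
  f : T.Iso M
  f_id : ∀ x : T, (x : V) ∉ N → (f x : V) = x
  f_fibre : ∀ (v : prodSet (Icc (-1) 1) Y.carrier) (x : T), (x : V) = b v →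
    ∃ w : prodSet (Icc (-1) 1) Y.carrier, (w : V) 0 ≤ 0 ∧ tail w = tail v ∧ (f x : V) = b w

/-! ### Systems of fields -/

universe u v

/-- The data of a system of fields of dimension `n`. Only the values in dimensions at most `n`
are meaningful. -/
structure FieldData (n : ℕ) where
  /-- the set of fields on a manifold -/
  C : ∀ {d : ℤ}, PLMan d → Type v
  /-- the action of homeomorphisms -/
  map : ∀ {d : ℤ} {X Y : PLMan d}, X.Iso Y → C X → C Y
  /-- restriction to the boundary -/
  bd : ∀ {d : ℤ} {X : PLMan d}, C X → C X.bdry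
  /-- the field on the empty manifold -/
  unit : ∀ {d : ℤ}, d ≤ n → ∀ {E : PLMan d}, E.carrier = ∅ → C E
  /-- the disjoint union of fields -/
  jux : ∀ {d : ℤ} {M A B : PLMan d}, DisjUnion M A B → C A → C B → C M
  /-- `Gl G x z` means that `x` can be glued along `G`, with result `z` -/
  Gl : ∀ {d : ℤ} {X Z : PLMan d} {Y₁ Y₂ W : PLMan (d - 1)}, Gluing X Z Y₁ Y₂ W → C X → C Z → Prop
  /-- the product field `c × I` -/
  prod : ∀ {d : ℤ}, d ≤ n → ∀ {Y : PLMan (d - 1)} {P : PLMan d}, Cylinder Y P → C Y → C P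

namespace FieldData

variable {n : ℕ} (F : FieldData.{v} n)

/-- The fields with boundary condition `c`. -/
def Fib {d : ℤ} {X : PLMan d} (c : F.C X.bdry) : Type v := {x : F.C X // F.bd x = c}

/-- The field `e` on `M = A₁ ∪ A₂ ∪ A₃` splits, with restrictions `a₁`, `a₂`, `a₃` to the pieces. -/
def SplitsInto {d : ℤ} {M A₁ A₂ A₃ : PLMan d} (e : F.C M) (a₁ : F.C A₁) (a₂ : F.C A₂)
    (a₃ : F.C A₃) : Prop :=
  ∃ K : Cut M A₁ A₂ A₃, F.Gl K.G (F.jux K.disj (F.jux K.disj₁₂ (F.map K.α₁.symm a₁)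
    (F.map K.α₂.symm a₂)) (F.map K.α₃.symm a₃)) e

/-- The field `e` on `∂X` splits along `∂Y₁` and `∂Y₂`, its restrictions to `Y₁` and `Y₂` correspond
to each other, and its restriction to `W` is `w`. -/
def Matches {d : ℤ} {X Z : PLMan d} {Y₁ Y₂ W : PLMan (d - 1)} (G : Gluing X Z Y₁ Y₂ W)
    (e : F.C X.bdry) (w : F.C W) : Prop :=
  ∃ y : F.C Y₁, F.SplitsInto e y (F.map G.h y) w

/-- Iterated gluing of fields. -/
def GlSeq {d : ℤ} {X T : PLMan d} : GluingSeq X T → F.C X → F.C T → Prop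
  | .nil _ => fun x z => x = z
  | .cons G S => fun x z => ∃ y, F.Gl G x y ∧ GlSeq S y z

/-- `Bullet u r z` means that `X` is the union of `A` and `R`, glued along `A ∩ R`, and that
`z = u • r` is the field on `X` obtained by gluing the fields `u` on `A` and `r` on `R`. -/
def Bullet {d : ℤ} {X A R : PLMan d} (u : F.C A) (r : F.C R) (z : F.C X) : Prop :=
  ∃ T : TwoPiece X A R, F.Gl T.G (F.jux T.disj (F.map T.α.symm u) (F.map T.ρ.symm r)) z

/-- `x'` is the image of `x` under a homeomorphism isotopic to the identity. -/
def IsotopyStep (rel : Prop) {d : ℤ} {M : PLMan d} (x x' : F.C M) : Prop :=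
  ∃ f : M.Iso M, IsotopicToId rel f ∧ x' = F.map f x

/-- `x'` is the image `f(x • (c × I))` of `x` under a collar map. (Gluing forces `c` to be the
restriction of `x` to `Y`.) -/
def CollarStep {d : ℤ} (hd : d ≤ n) {M : PLMan d} (x x' : F.C M) : Prop :=
  ∃ (K : Collar M) (c : F.C K.Y) (t : F.C K.T),
    F.Gl K.glue.G (F.jux K.glue.disj (F.map K.glue.α.symm x)
      (F.map K.glue.ρ.symm (F.prod hd K.θ c))) t ∧ x' = F.map K.f t

/-- The equivalence relation generated by collar maps and homeomorphisms isotopic to the identity. -/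
def IsotopyCollarEquiv {d : ℤ} (hd : d ≤ n) {M : PLMan d} : F.C M → F.C M → Prop :=
  Relation.EqvGen fun x x' => F.IsotopyStep False x x' ∨ F.CollarStep hd x x'

/-- Extended isotopy of fields with boundary condition `c`: the equivalence relation generated by
collar maps and homeomorphisms isotopic to the identity rel boundary. -/
def ExtendedIsotopic {d : ℤ} (hd : d ≤ n) {M : PLMan d} {c : F.C M.bdry} :
    F.Fib c → F.Fib c → Prop :=
  Relation.EqvGen fun x x' => F.IsotopyStep True x.1 x'.1 ∨ F.CollarStep hd x.1 x'.1

end FieldData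

open scoped Uniformity TensorProduct

/-- The data of a system of fields, where the sets of `n`-dimensional fields with a given boundary
condition are vector spaces over `K`. -/
structure LinearFieldData (K : Type u) [Field K] (n : ℕ) extends FieldData.{v} n where
  addCommGroup : ∀ {X : PLMan (n : ℤ)} (c : C X.bdry), AddCommGroup (toFieldData.Fib c)
  module : ∀ {X : PLMan (n : ℤ)} (c : C X.bdry), Module K (toFieldData.Fib c)

attribute [instance] LinearFieldData.addCommGroup LinearFieldData.module

/-- An `n`-dimensional system of fields enriched over vector spaces over `K`. -/
structure SystemOfFields (K : Type u) [Field K] (n : ℕ) extends LinearFieldData.{u, v} K n where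
  -- homeomorphisms act functorially
  map_refl : ∀ {d : ℤ}, d ≤ n → ∀ {X : PLMan d} (x : C X), map (PLHomeo.refl X.carrier) x = x
  map_trans : ∀ {d : ℤ}, d ≤ n → ∀ {X Y Z : PLMan d} (f : X.Iso Y) (g : Y.Iso Z) (x : C X),
    map (f.trans g) x = map g (map f x)
  -- boundary restrictions form a natural transformation
  bd_map : ∀ {d : ℤ}, d ≤ n → ∀ {X Y : PLMan d} (f : X.Iso Y) (x : C X),
    bd (map f x) = map f.bdry (bd x)
  map_linear : ∀ {X Y : PLMan (n : ℤ)} (f : X.Iso Y) (c : C X.bdry),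
    ∃ L : toFieldData.Fib c →ₗ[K] toFieldData.Fib (map f.bdry c), ∀ x, (L x).1 = map f x.1
  -- compatibility with disjoint unions
  jux_map : ∀ {d : ℤ}, d ≤ n → ∀ {M A B M' A' B' : PLMan d} (h : DisjUnion M A B)
    (h' : DisjUnion M' A' B') (f : M.Iso M') (g : A.Iso A') (k : B.Iso B'),
    (∀ (x : M) (y : A), (x : V) = y → (f x : V) = g y) →
    (∀ (x : M) (y : B), (x : V) = y → (f x : V) = k y) →
    ∀ a b, map f (jux h a b) = jux h' (map g a) (map k b)
  jux_comm : ∀ {d : ℤ}, d ≤ n → ∀ {M A B : PLMan d} (h : DisjUnion M A B) (a : C A) (b : C B),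
    jux h.symm b a = jux h a b
  jux_assoc : ∀ {d : ℤ}, d ≤ n → ∀ {M A₁ A₂ A₃ A₁₂ A₂₃ : PLMan d} (h₁₂ : DisjUnion A₁₂ A₁ A₂)
    (h : DisjUnion M A₁₂ A₃) (h₂₃ : DisjUnion A₂₃ A₂ A₃) (h' : DisjUnion M A₁ A₂₃)
    (a₁ : C A₁) (a₂ : C A₂) (a₃ : C A₃),
    jux h (jux h₁₂ a₁ a₂) a₃ = jux h' a₁ (jux h₂₃ a₂ a₃)
  jux_unit : ∀ {d : ℤ} (hd : d ≤ n) {A E : PLMan d} (hE : E.carrier = ∅) (h : DisjUnion A E A)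
    (a : C A), jux h (unit hd hE) a = a
  bd_jux : ∀ {d : ℤ}, d ≤ n → ∀ {M A B : PLMan d} (h : DisjUnion M A B) (a : C A) (b : C B),
    bd (jux h a b) = jux h.bdry (bd a) (bd b)
  jux_bijective : ∀ {d : ℤ}, d < n → ∀ {M A B : PLMan d} (h : DisjUnion M A B),
    Function.Bijective fun p : C A × C B => jux h p.1 p.2
  unit_unique : ∀ {d : ℤ} (hd : d < n) {E : PLMan d} (hE : E.carrier = ∅) (x : C E),
    x = unit hd.le hE
  jux_tensor : ∀ {M A B : PLMan (n : ℤ)} (h : DisjUnion M A B) (a : C A.bdry) (b : C B.bdry),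
    ∃ L : toFieldData.Fib a →ₗ[K] toFieldData.Fib b →ₗ[K] toFieldData.Fib (jux h.bdry a b),
      (∀ x y, (L x y).1 = jux h x.1 y.1) ∧ IsTensorProduct L
  unit_basis : ∀ {E : PLMan (n : ℤ)} (hE : E.carrier = ∅) (c : C E.bdry),
    ∃ L : K ≃ₗ[K] toFieldData.Fib c, (L 1).1 = unit le_rfl hE
  -- gluing: which fields can be glued, and uniqueness of the result
  gl_domain : ∀ {d : ℤ}, d ≤ n → ∀ {X Z : PLMan d} {Y₁ Y₂ W : PLMan (d - 1)}
    (G : Gluing X Z Y₁ Y₂ W) (x : C X), (∃ z, Gl G x z) ↔ ∃ w, toFieldData.Matches G (bd x) w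
  -- any two sequences of gluings with the same effect on the manifold agree on fields
  gl_assoc : ∀ {d : ℤ}, d ≤ n → ∀ {X T : PLMan d} (S S' : GluingSeq X T), S.quot = S'.quot →
    ∀ x z z', toFieldData.GlSeq S x z → toFieldData.GlSeq S' x z' → z = z'
  gl_injective : ∀ {d : ℤ}, d < n → ∀ {X Z : PLMan d} {Y₁ Y₂ W : PLMan (d - 1)}
    (G : Gluing X Z Y₁ Y₂ W) (x x' : C X) (z : C Z), Gl G x z → Gl G x' z → x = x'
  gl_injective_top : ∀ {X Z : PLMan (n : ℤ)} {Y₁ Y₂ W : PLMan ((n : ℤ) - 1)}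
    (G : Gluing X Z Y₁ Y₂ W) (x x' : C X) (z : C Z), bd x = bd x' → Gl G x z → Gl G x' z → x = x'
  gl_linear : ∀ {X Z : PLMan (n : ℤ)} {Y₁ Y₂ W : PLMan ((n : ℤ) - 1)} (G : Gluing X Z Y₁ Y₂ W)
    (e : C X.bdry) (w : C W), toFieldData.Matches G e w →
    ∃ (c : C Z.bdry) (L : toFieldData.Fib e →ₗ[K] toFieldData.Fib c), ∀ x, Gl G x.1 (L x).1
  -- gluing is compatible with homeomorphisms, boundary restrictions, disjoint unions
  gl_map : ∀ {d : ℤ}, d ≤ n → ∀ {X Z X' Z' : PLMan d} {Y₁ Y₂ W Y₁' Y₂' W' : PLMan (d - 1)}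
    (G : Gluing X Z Y₁ Y₂ W) (G' : Gluing X' Z' Y₁' Y₂' W') (f : X.Iso X') (g : Z.Iso Z'),
    (∀ x : X, (x : V) ∈ Y₁.carrier ↔ (f x : V) ∈ Y₁'.carrier) →
    (∀ x : X, (x : V) ∈ Y₂.carrier ↔ (f x : V) ∈ Y₂'.carrier) →
    (∀ x : X, g (G.q x) = G'.q (f x)) →
    ∀ x z, Gl G x z → Gl G' (map f x) (map g z)
  gl_bd : ∀ {d : ℤ}, d ≤ n → ∀ {X Z : PLMan d} {Y₁ Y₂ W : PLMan (d - 1)} {E : PLMan (d - 1 - 1)}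
    (G : Gluing X Z Y₁ Y₂ W) (G' : Gluing W Z.bdry Y₁.bdry Y₂.bdry E), G.IsBoundary G' →
    ∀ x z w, Gl G x z → toFieldData.Matches G (bd x) w → Gl G' w (bd z)
  gl_jux : ∀ {d : ℤ}, d ≤ n → ∀ {X Z X' Z' T T' : PLMan d} {Y₁ Y₂ W W' : PLMan (d - 1)}
    (G : Gluing X Z Y₁ Y₂ W) (G' : Gluing X' Z' Y₁ Y₂ W') (h : DisjUnion X' X T)
    (h' : DisjUnion Z' Z T') (f : T.Iso T'),
    (∀ (x' : X') (x : X), (x' : V) = x → (G'.q x' : V) = G.q x) →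
    (∀ (x' : X') (t : T), (x' : V) = t → (G'.q x' : V) = f t) →
    ∀ x z t, Gl G x z → Gl G' (jux h x t) (jux h' z (map f t))
  -- nothing happens to fields if the gluing is along the empty manifold
  gl_empty : ∀ {d : ℤ}, d ≤ n → ∀ {X Z : PLMan d} {Y₁ Y₂ W : PLMan (d - 1)}
    (G : Gluing X Z Y₁ Y₂ W) (f : X.Iso Z), Y₁.carrier = ∅ → (∀ x, f x = G.q x) →
    ∀ x, Gl G x (map f x)
  -- gluing is surjective up to homeomorphisms isotopic to the identity and collar maps
  gl_surjective : ∀ {d : ℤ} (hd : d < n) {X Z : PLMan d} {Y₁ Y₂ W : PLMan (d - 1)}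
    {E : PLMan (d - 1 - 1)} (G : Gluing X Z Y₁ Y₂ W) (G' : Gluing W Z.bdry Y₁.bdry Y₂.bdry E),
    G.IsBoundary G' → ∀ (z : C Z) (w : C W), Gl G' w (bd z) →
    ∃ x z', Gl G x z' ∧ toFieldData.IsotopyCollarEquiv hd.le z' z
  gl_surjective_top : ∀ {X Z : PLMan (n : ℤ)} {Y₁ Y₂ W : PLMan ((n : ℤ) - 1)}
    {E : PLMan ((n : ℤ) - 1 - 1)} (G : Gluing X Z Y₁ Y₂ W)
    (G' : Gluing W Z.bdry Y₁.bdry Y₂.bdry E), G.IsBoundary G' →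
    ∀ (c : C Z.bdry) (w : C W), Gl G' w c → ∀ z : toFieldData.Fib c,
    z ∈ Submodule.span K {z₁ : toFieldData.Fib c |
      ∃ x z₂, Gl G x z₂ ∧ toFieldData.IsotopyCollarEquiv le_rfl z₂ z₁.1}
  -- every field splits along arbitrarily small perturbations of a codimension one submanifold
  splitting : ∀ {d : ℤ}, d < n → ∀ {X Z : PLMan d} {Y₁ Y₂ W : PLMan (d - 1)}
    (G : Gluing X Z Y₁ Y₂ W) (z : C Z), ∀ O ∈ 𝓤 V, ∃ (g : Z.Iso Z) (G' : Gluing X Z Y₁ Y₂ W),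
    (∀ p : Z, ((p : V), (g p : V)) ∈ O) ∧ (∀ x, G'.q x = g (G.q x)) ∧ ∃ x, Gl G' x z
  splitting_top : ∀ {X Z : PLMan (n : ℤ)} {Y₁ Y₂ W : PLMan ((n : ℤ) - 1)}
    (G : Gluing X Z Y₁ Y₂ W) (c : C Z.bdry) (z : toFieldData.Fib c), ∀ O ∈ 𝓤 V,
    ∃ (g : Z.Iso Z) (G' : Gluing X Z Y₁ Y₂ W),
    (∀ p : Z, ((p : V), (g p : V)) ∈ O) ∧ (∀ x, G'.q x = g (G.q x)) ∧
    z ∈ Submodule.span K {z' : toFieldData.Fib c | ∃ x, Gl G' x z'.1}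
  -- product fields
  prod_map : ∀ {d : ℤ} (hd : d ≤ n) {Y Y' : PLMan (d - 1)} {P P' : PLMan d} (θ : Cylinder Y P)
    (θ' : Cylinder Y' P') (f : P.Iso P') (g : Y.Iso Y'),
    (∀ (p : P) (y : Y), tail (θ p) = y → tail (θ' (f p)) = g y) →
    ∀ c, map f (prod hd θ c) = prod hd θ' (map g c)
  prod_jux : ∀ {d : ℤ} (hd : d ≤ n) {Y A B : PLMan (d - 1)} {P Q R : PLMan d} (θ : Cylinder Y P)
    (θ₁ : Cylinder A Q) (θ₂ : Cylinder B R) (h : DisjUnion Y A B) (h' : DisjUnion P Q R),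
    (∀ (p : P) (p' : Q), (p : V) = p' → (θ p : V) = θ₁ p') →
    (∀ (p : P) (p' : R), (p : V) = p' → (θ p : V) = θ₂ p') →
    ∀ a b, prod hd θ (jux h a b) = jux h' (prod hd θ₁ a) (prod hd θ₂ b)
  -- the boundary of `Y × I` consists of `Y × {0}`, `Y × {1}` and `∂Y × I`
  bd_prod : ∀ {d : ℤ} (hd : d ≤ n) {Y Y₀ Y₁ S : PLMan (d - 1)} {P : PLMan d} (θ : Cylinder Y P)
    (i₀ : Y.Iso Y₀) (i₁ : Y.Iso Y₁) (θ_S : Cylinder Y.bdry S),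
    Y₀.carrier ⊆ P.carrier → Y₁.carrier ⊆ P.carrier → S.carrier ⊆ P.carrier →
    (∀ (p : P) (y : Y), (p : V) = i₀ y → (θ p : V) = cons 0 y) →
    (∀ (p : P) (y : Y), (p : V) = i₁ y → (θ p : V) = cons 1 y) →
    (∀ (p : P) (s : S), (p : V) = s → (θ p : V) = θ_S s) →
    ∀ c, toFieldData.SplitsInto (bd (prod hd θ c)) (map i₀ c) (map i₁ c)
      (prod ((sub_le_self d zero_le_one).trans hd) θ_S (bd c))
  prod_gl : ∀ {d : ℤ} (hd : d ≤ n) {Y Y' : PLMan (d - 1)} {A₁ A₂ B : PLMan (d - 1 - 1)}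
    {P P' : PLMan d} {Q₁ Q₂ S : PLMan (d - 1)} (θ : Cylinder Y P) (θ' : Cylinder Y' P')
    (G : Gluing Y Y' A₁ A₂ B) (G' : Gluing P P' Q₁ Q₂ S),
    (∀ (p : P) (y : Y), tail (θ p) = y →
      (θ' (G'.q p) : V) = cons ((θ p : V) 0) (G.q y)) →
    ∀ c c', Gl G c c' → Gl G' (prod hd θ c) (prod hd θ' c')

namespace SystemOfFields

variable {K : Type u} [Field K] {n : ℕ} (F : SystemOfFields.{u, v} K n)

/-- The vector space `F(X; c)` of fields on the `n`-manifold `X` with boundary condition `c`. -/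
abbrev Fld {X : PLMan (n : ℤ)} (c : F.C X.bdry) : Type v := F.toFieldData.Fib c

/-- The map `F(X; c) → F(Y; f(c))` induced by a homeomorphism `f : X → Y`. -/
def mapFld {X Y : PLMan (n : ℤ)} (f : X.Iso Y) (c : F.C X.bdry) (x : F.Fld c) :
    F.Fld (F.map f.bdry c) :=
  ⟨F.map f x.1, by rw [F.bd_map le_rfl, x.2]⟩

end SystemOfFields

/-- A local relation for a system of fields. -/
structure LocalRelation {K : Type u} [Field K] {n : ℕ} (F : SystemOfFields.{u, v} K n) where
  /-- the subspace `U(B; c)` of `F(B; c)` -/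
  U : ∀ {B : PLMan (n : ℤ)}, IsBall n B.carrier → ∀ c : F.C B.bdry, Submodule K (F.Fld c)
  functorial : ∀ {B B' : PLMan (n : ℤ)} (hB : IsBall n B.carrier) (hB' : IsBall n B'.carrier)
    (f : B.Iso B') (c : F.C B.bdry), F.mapFld f c '' (U hB c) = U hB' (F.map f.bdry c)
  extendedIsotopy : ∀ {B : PLMan (n : ℤ)} (hB : IsBall n B.carrier) (c : F.C B.bdry)
    (x y : F.Fld c), F.ExtendedIsotopic le_rfl x y → x - y ∈ U hB c
  ideal : ∀ {B B' B'' : PLMan (n : ℤ)} (hB : IsBall n B.carrier) (hB' : IsBall n B'.carrier)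
    (c : F.C B.bdry) (c' : F.C B'.bdry) (x : F.Fld c') (r : F.C B'') (z : F.Fld c),
    x ∈ U hB' c' → F.Bullet x.1 r z.1 → z ∈ U hB c

/-! ### The skein module and the blob complex in low degrees -/

/-- A blob in `X`: an embedded closed ball `B ⊆ X` whose closed complement `R` is a manifold, such
that `X` is obtained by gluing `B` and `R` along `B ∩ R`. (Since `R` is determined by `B`, a blob is
simply a subset of `X`.) -/
structure EmbeddedBall {n : ℕ} (X : PLMan (n : ℤ)) where
  B : PLMan (n : ℤ)
  R : PLMan (n : ℤ)
  isBall : IsBall n B.carrier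
  subset : B.carrier ⊆ X.carrier
  complement : R.carrier = closure (X.carrier \ B.carrier)
  glue : Nonempty (TwoPiece X B R)

namespace LocalRelation

variable {K : Type u} [Field K] {n : ℕ} {F : SystemOfFields.{u, v} K n} (𝒰 : LocalRelation F)

/-- The space `U(X; c)` of local relations: the span of the fields `u • r` in `F(X; c)`, where
`u ∈ U(B)` for some embedded ball `B` in `X`, and `r` is a field on `X ∖ B`. -/
def relations {X : PLMan (n : ℤ)} (c : F.C X.bdry) : Submodule K (F.Fld c) :=
  Submodule.span K {z | ∃ (β : EmbeddedBall X) (b : F.C β.B.bdry) (u : F.Fld b) (r : F.C β.R),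
    u ∈ 𝒰.U β.isBall b ∧ F.Bullet u.1 r z.1}

/-- The skein module `A(X; c) = F(X; c) / U(X; c)`. -/
abbrev Skein {X : PLMan (n : ℤ)} (c : F.C X.bdry) : Type v := F.Fld c ⧸ 𝒰.relations c

variable (F) in
/-- The pairs of a boundary condition `b` for the blob `B` and a boundary condition `s` for `X ∖ B`
which agree with each other along `B ∩ (X ∖ B)` and with `c` on `∂X`; in other words, for which there
is a gluing map `• : F(B; b) ⊗ F(X ∖ B; s) → F(X; c)`. If `X` is closed, then `∂B = ∂(X ∖ B)`
and this means that `b` and `s` are equal. -/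
structure BlobBC {X : PLMan (n : ℤ)} (c : F.C X.bdry) (β : EmbeddedBall X) where
  b : F.C β.B.bdry
  s : F.C β.R.bdry
  exists_bullet : ∃ L : F.Fld b →ₗ[K] F.Fld s →ₗ[K] F.Fld c,
    ∀ u r, F.Bullet u.1 r.1 (L u r).1

/-- The gluing map `•` of fields on `B` with fields on `X ∖ B`. -/
noncomputable def BlobBC.bullet {X : PLMan (n : ℤ)} {c : F.C X.bdry} {β : EmbeddedBall X}
    (p : BlobBC F c β) : F.Fld p.b →ₗ[K] F.Fld p.s →ₗ[K] F.Fld c :=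
  p.exists_bullet.choose

/-- `B₀(X; c) = F(X; c)`. -/
abbrev B₀ (_ : LocalRelation F) {X : PLMan (n : ℤ)} (c : F.C X.bdry) : Type v := F.Fld c

/-- `B₁(X; c)` is the direct sum of `U(B; b) ⊗ F(X ∖ B; s)` over all blobs and boundary conditions. -/
abbrev B₁ {X : PLMan (n : ℤ)} (c : F.C X.bdry) : Type v :=
  DirectSum (EmbeddedBall X) fun β => DirectSum (BlobBC F c β) fun p =>
    (𝒰.U β.isBall p.b) ⊗[K] F.Fld p.s

open Classical in
/-- The differential `∂ : B₁(X; c) → B₀(X; c)`, `(B, u, r) ↦ u • r`. -/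
noncomputable def boundary {X : PLMan (n : ℤ)} (c : F.C X.bdry) : 𝒰.B₁ c →ₗ[K] 𝒰.B₀ c :=
  DirectSum.toModule K _ _ fun β => DirectSum.toModule K _ _ fun p =>
    TensorProduct.lift (p.bullet.comp (𝒰.U β.isBall p.b).subtype)

/-- The 0-th blob homology `B₀(X; c) / ∂(B₁(X; c))`. -/
abbrev H₀ {X : PLMan (n : ℤ)} (c : F.C X.bdry) : Type _ := 𝒰.B₀ c ⧸ LinearMap.range (𝒰.boundary c)

end LocalRelation

end BlobComplex

open BlobComplex

namespace BlobComplex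

open scoped TensorProduct

/-! Both modules are quotients of `F(X; c)`, so the isomorphism amounts to the equality of two
subspaces, the image of `∂` and the span of the relations `u • r` (`LocalRelation.range_boundary`).
On pure tensors `∂(u ⊗ r) = u • r` is a relation, which gives one inclusion. The other requires
every relation to occur in some summand of `B₁`, and two facts about gluing make this work.

First, a relation `u • r` specifies a field `r` on the complement but no bilinear gluing map. The
boundary condition of `r` is taken to be its restriction `s` to the boundary. Whether fields can be
glued depends only on their boundary restrictions, so one gluable pair makes gluing defined and
bilinear on `F(B; b) × F(X ∖ B; s)` (`exists_bilinear_bullet`).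

Second, the bilinear map in `∂` is a chosen one, and `Bullet` allows any presentation of `X` as a
union of `B` and its complement. Two presentations differ by a homeomorphism over `X`, because the
gluing loci are recovered from the subsets themselves. Hence `u • r` is unique (`bullet_unique`).

For naturality, a homeomorphism carries blobs, their complements and presentations to such data in
the target. It therefore carries relations to relations (`mapFld_mem_relations`), and the square of
quotient maps commutes on representatives. Most of the length is the PL topology behind these
transports. -/

theorem PLHomeo.ext_fun {A B : Set V} {f g : PLHomeo A B} (h : ∀ x, f x = g x) : f = g := by
  obtain ⟨f, _, _⟩ := f
  obtain ⟨g, _, _⟩ := g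
  obtain rfl : f = g := Homeomorph.ext h
  rfl

/-! ### Assembling maps and homeomorphisms from two closed pieces -/

theorem IsCell.inter {K L : Set V} (hK : IsCell K) (hL : IsCell L) : IsCell (K ∩ L) :=
  hK.inter_preimage hL (AffineMap.id ℝ V)

/-- A map which is piecewise linear on each of two polyhedra covering its domain is piecewise
linear. -/
theorem IsPL.union {M M' A A' B B' : Set V} {f : A → A'} {g : B → B'} {k : M → M'} (hf : IsPL f)
    (hg : IsPL g) (hA : IsPolyhedron A) (hB : IsPolyhedron B) (hM : M ⊆ A ∪ B)
    (hkf : ∀ (x : M) (y : A), (x : V) = y → (k x : V) = f y)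
    (hkg : ∀ (x : M) (y : B), (x : V) = y → (k x : V) = g y) : IsPL k := by
  obtain ⟨ι, _, K, a, hK, hKc, ha⟩ := hf
  obtain ⟨κ, _, L, b, hL, hLc, hb⟩ := hg
  obtain ⟨_, P, hP, hPc, rfl⟩ := hA
  obtain ⟨_, Q, hQ, hQc, rfl⟩ := hB
  have := hP.to_subtype
  have := hQ.to_subtype
  obtain ⟨N, ⟨eP⟩⟩ := Finite.exists_equiv_fin P
  obtain ⟨N', ⟨eQ⟩⟩ := Finite.exists_equiv_fin Q
  -- The cells `K i` may contain points of `M` outside `A`, where `a i` says nothing about `k`.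
  -- Intersecting them with the cells of the polyhedron `A` confines them to `A`; the same is done
  -- for `B`.
  refine ⟨(ι × Fin N) ⊕ (κ × Fin N'), inferInstance,
    Sum.elim (fun p => K p.1 ∩ eP.symm p.2) (fun p => L p.1 ∩ eQ.symm p.2),
    Sum.elim (fun p => a p.1) (fun p => b p.1), ?_, fun x => ?_, ?_⟩
  · rintro (p | p)
    · exact (hK _).inter (hPc _ (eP.symm p.2).2)
    · exact (hL _).inter (hQc _ (eQ.symm p.2).2)
  · rcases hM x.2 with hx | hx
    · obtain ⟨i, hi⟩ := hKc ⟨x, hx⟩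
      obtain ⟨T, hT, hxT⟩ := hx
      exact ⟨.inl (i, eP ⟨T, hT⟩), hi, by simpa using hxT⟩
    · obtain ⟨i, hi⟩ := hLc ⟨x, hx⟩
      obtain ⟨T, hT, hxT⟩ := hx
      exact ⟨.inr (i, eQ ⟨T, hT⟩), hi, by simpa using hxT⟩
  · rintro (p | p) x ⟨hx, hx'⟩
    · have h : (x : V) ∈ ⋃₀ P := ⟨_, (eP.symm p.2).2, hx'⟩
      rw [hkf x ⟨x, h⟩ rfl, ha p.1 ⟨x, h⟩ hx]
      rfl
    · have h : (x : V) ∈ ⋃₀ Q := ⟨_, (eQ.symm p.2).2, hx'⟩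
      rw [hkg x ⟨x, h⟩ rfl, hb p.1 ⟨x, h⟩ hx]
      rfl

/-- The pasting lemma for two closed sets, with continuity tested after including the target into
`V`. The agreement conditions compare points in `V`, since `A` and `B` are not subtypes of `M`. -/
theorem continuous_of_union {M M' A A' B B' : Set V} {f : A → A'} {g : B → B'} {k : M → M'}
    (hf : Continuous f) (hg : Continuous g) (hA : IsClosed A) (hB : IsClosed B) (hM : M ⊆ A ∪ B)
    (hkf : ∀ (x : M) (y : A), (x : V) = y → (k x : V) = f y)
    (hkg : ∀ (x : M) (y : B), (x : V) = y → (k x : V) = g y) : Continuous k := by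
  rw [continuous_induced_rng, ← continuousOn_univ]
  have h1 : ContinuousOn (Subtype.val ∘ k) (Subtype.val ⁻¹' A) := by
    rw [continuousOn_iff_continuous_domRestrict]
    have : Continuous fun x : (Subtype.val ⁻¹' A : Set M) => (f ⟨x.1.1, x.2⟩ : V) :=
      continuous_subtype_val.comp (hf.comp (by fun_prop))
    convert this using 2 with x
    exact hkf x.1 ⟨x.1.1, x.2⟩ rfl
  have h2 : ContinuousOn (Subtype.val ∘ k) (Subtype.val ⁻¹' B) := by
    rw [continuousOn_iff_continuous_domRestrict]
    have : Continuous fun x : (Subtype.val ⁻¹' B : Set M) => (g ⟨x.1.1, x.2⟩ : V) :=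
      continuous_subtype_val.comp (hg.comp (by fun_prop))
    convert this using 2 with x
    exact hkg x.1 ⟨x.1.1, x.2⟩ rfl
  refine (h1.union_of_isClosed h2 (hA.preimage continuous_subtype_val)
    (hB.preimage continuous_subtype_val)).mono fun x _ => hM x.2

/-- Homeomorphisms of the two parts of a disjoint union assemble to a map. -/
theorem DisjUnion.exists_map {d : ℤ} {M A B M' A' B' : PLMan d} (h : DisjUnion M A B)
    (h' : DisjUnion M' A' B') (f : A.Iso A') (g : B.Iso B') :
    ∃ k : M → M', (∀ (x : M) (y : A), (x : V) = y → (k x : V) = f y) ∧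
      ∀ (x : M) (y : B), (x : V) = y → (k x : V) = g y := by
  have key : ∀ x : M, ∃ x' : M', (∀ y : A, (x : V) = y → (x' : V) = f y) ∧
      ∀ y : B, (x : V) = y → (x' : V) = g y := by
    intro x
    have hx : (x : V) ∈ A.carrier ∪ B.carrier := by rw [h.union]; exact x.2
    rcases hx with hx | hx
    · refine ⟨⟨f ⟨x, hx⟩, by rw [← h'.union]; exact Or.inl (f ⟨x, hx⟩).2⟩, ?_, ?_⟩
      · intro y hy
        obtain rfl : y = ⟨x, hx⟩ := Subtype.ext hy.symm
        rfl
      · intro y hy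
        exact (disjoint_left.1 h.disjoint hx (hy ▸ y.2)).elim
    · refine ⟨⟨g ⟨x, hx⟩, by rw [← h'.union]; exact Or.inr (g ⟨x, hx⟩).2⟩, ?_, ?_⟩
      · intro y hy
        exact (disjoint_left.1 h.disjoint (hy ▸ y.2) hx).elim
      · intro y hy
        obtain rfl : y = ⟨x, hx⟩ := Subtype.ext hy.symm
        rfl
  choose k hk using key
  exact ⟨k, fun x => (hk x).1, fun x => (hk x).2⟩

/-- Checked on each piece separately. Since `f.symm.symm` is `f` by definition, exchanging the roles
of `k` and `l` also yields the other inverse identity. -/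
theorem DisjUnion.map_leftInverse {d : ℤ} {M A B M' A' B' : PLMan d} (h : DisjUnion M A B)
    {f : A.Iso A'} {g : B.Iso B'} {k : M → M'} {l : M' → M}
    (hkf : ∀ (x : M) (y : A), (x : V) = y → (k x : V) = f y)
    (hkg : ∀ (x : M) (y : B), (x : V) = y → (k x : V) = g y)
    (hlf : ∀ (x : M') (y : A'), (x : V) = y → (l x : V) = f.symm y)
    (hlg : ∀ (x : M') (y : B'), (x : V) = y → (l x : V) = g.symm y) :
    Function.LeftInverse l k := by
  intro x
  have hx : (x : V) ∈ A.carrier ∪ B.carrier := by rw [h.union]; exact x.2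
  apply Subtype.ext
  rcases hx with hx | hx
  · rw [hlf _ _ (hkf x ⟨x, hx⟩ rfl), f.symm_apply_apply]
  · rw [hlg _ _ (hkg x ⟨x, hx⟩ rfl), g.symm_apply_apply]

/-- The disjoint union of two homeomorphisms. -/
theorem DisjUnion.exists_iso {d : ℤ} {M A B M' A' B' : PLMan d} (h : DisjUnion M A B)
    (h' : DisjUnion M' A' B') (f : A.Iso A') (g : B.Iso B') :
    ∃ k : M.Iso M', (∀ (x : M) (y : A), (x : V) = y → (k x : V) = f y) ∧
      ∀ (x : M) (y : B), (x : V) = y → (k x : V) = g y := by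
  obtain ⟨k, hkf, hkg⟩ := h.exists_map h' f g
  obtain ⟨l, hlf, hlg⟩ := h'.exists_map h f.symm g.symm
  have hlk : Function.LeftInverse l k := h.map_leftInverse hkf hkg hlf hlg
  have hkl : Function.LeftInverse k l :=
    h'.map_leftInverse (f := f.symm) (g := g.symm) hlf hlg hkf hkg
  exact ⟨⟨⟨⟨k, l, hlk, hkl⟩,
      continuous_of_union f.continuous_toFun g.continuous_toFun A.isPolyhedron.1.isClosed
        B.isPolyhedron.1.isClosed h.union.ge hkf hkg,
      continuous_of_union f.continuous_invFun g.continuous_invFun A'.isPolyhedron.1.isClosed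
        B'.isPolyhedron.1.isClosed h'.union.ge hlf hlg⟩,
      f.isPL.union g.isPL A.isPolyhedron B.isPolyhedron h.union.ge hkf hkg,
      f.isPL_inv.union g.isPL_inv A'.isPolyhedron B'.isPolyhedron h'.union.ge hlf hlg⟩, hkf, hkg⟩

/-! ### Presentations as a union of two pieces -/

namespace TwoPiece

variable {d : ℤ} {X A R : PLMan d} (T : TwoPiece X A R)

theorem subset_D_left : T.A'.carrier ⊆ T.D.carrier := by
  rw [← T.disj.union]; exact subset_union_left

theorem subset_D_right : T.R'.carrier ⊆ T.D.carrier := by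
  rw [← T.disj.union]; exact subset_union_right

/-- This recovers the gluing locus from the subsets `A` and `R` alone. A point of `Y₁` is identified
with its partner under `h`, which lies in `R'` and so over `R`. Conversely, if `α x` lies in `R`,
then `x` and a point of `R'` have the same image under `q`. As `A'` and `R'` are disjoint, the only
alternative in `q_eq_iff` that survives is `x ∈ Y₁`. -/
theorem mem_Y₁_iff (x : T.A') : (x : V) ∈ T.Y₁.carrier ↔ (T.α x : V) ∈ R.carrier := by
  constructor
  · intro hx
    have hy : (T.G.h ⟨x, hx⟩ : V) ∈ T.R'.carrier := T.subset_R' (T.G.h ⟨x, hx⟩).2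
    have h := (T.G.q_eq_iff ⟨x, T.subset_D_left x.2⟩ ⟨_, T.subset_D_right hy⟩).2
      (Or.inr (Or.inl ⟨⟨x, hx⟩, rfl, rfl⟩))
    rw [← T.q_eq_α ⟨x, T.subset_D_left x.2⟩ x rfl, h, T.q_eq_ρ _ ⟨_, hy⟩ rfl]
    exact Subtype.prop _
  · intro hx
    have hz : (T.ρ.symm ⟨_, hx⟩ : V) ∈ T.R'.carrier := Subtype.prop _
    have h : T.G.q ⟨x, T.subset_D_left x.2⟩ = T.G.q ⟨_, T.subset_D_right hz⟩ := by
      apply Subtype.ext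
      rw [T.q_eq_α _ x rfl, T.q_eq_ρ _ (T.ρ.symm ⟨_, hx⟩) rfl, T.ρ.apply_symm_apply]
    rcases (T.G.q_eq_iff _ _).1 h with h | ⟨y, hy, -⟩ | ⟨y, -, hy⟩
    · have h := congrArg Subtype.val h
      exact (disjoint_left.1 T.disj.disjoint x.2 (by rw [show (x : V) = _ from h]; exact hz)).elim
    · change (x : V) = y at hy
      rw [hy]; exact y.2
    · change (x : V) = T.G.h y at hy
      exact (disjoint_left.1 T.disj.disjoint x.2
        (by rw [hy]; exact T.subset_R' (Subtype.prop _))).elim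

/-- The mirror image of `mem_Y₁_iff`, using the inverse of `h` to find the partner. -/
theorem mem_Y₂_iff (x : T.R') : (x : V) ∈ T.Y₂.carrier ↔ (T.ρ x : V) ∈ A.carrier := by
  constructor
  · intro hx
    have hy : (T.G.h.symm ⟨x, hx⟩ : V) ∈ T.A'.carrier := T.subset_A' (T.G.h.symm ⟨x, hx⟩).2
    have h := (T.G.q_eq_iff ⟨_, T.subset_D_left hy⟩ ⟨x, T.subset_D_right x.2⟩).2
      (Or.inr (Or.inl ⟨T.G.h.symm ⟨x, hx⟩, rfl, by rw [T.G.h.apply_symm_apply]⟩))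
    rw [← T.q_eq_ρ ⟨x, T.subset_D_right x.2⟩ x rfl, ← h, T.q_eq_α _ ⟨_, hy⟩ rfl]
    exact Subtype.prop _
  · intro hx
    have hz : (T.α.symm ⟨_, hx⟩ : V) ∈ T.A'.carrier := Subtype.prop _
    have h : T.G.q ⟨_, T.subset_D_left hz⟩ = T.G.q ⟨x, T.subset_D_right x.2⟩ := by
      apply Subtype.ext
      rw [T.q_eq_ρ ⟨x, _⟩ x rfl, T.q_eq_α _ (T.α.symm ⟨_, hx⟩) rfl, T.α.apply_symm_apply]
    rcases (T.G.q_eq_iff _ _).1 h with h | ⟨y, -, hy⟩ | ⟨y, hy, -⟩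
    · have h := congrArg Subtype.val h
      exact (disjoint_left.1 T.disj.disjoint hz
        (by rw [show (T.α.symm ⟨_, hx⟩ : V) = x from h]; exact x.2)).elim
    · change (x : V) = T.G.h y at hy
      rw [hy]; exact Subtype.prop _
    · change (x : V) = y at hy
      exact (disjoint_left.1 T.disj.disjoint (by rw [hy]; exact T.subset_A' y.2) x.2).elim

/-- Any two presentations of `X` as a union of `A` and `R` are homeomorphic. -/
theorem exists_iso (T' : TwoPiece X A R) : ∃ k : T.D.Iso T'.D,
    (∀ (x : T.D) (y : T.A'), (x : V) = y → (k x : V) = (T.α.trans T'.α.symm) y) ∧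
    (∀ (x : T.D) (y : T.R'), (x : V) = y → (k x : V) = (T.ρ.trans T'.ρ.symm) y) ∧
    (∀ x : T.D, (x : V) ∈ T.Y₁.carrier ↔ (k x : V) ∈ T'.Y₁.carrier) ∧
    (∀ x : T.D, (x : V) ∈ T.Y₂.carrier ↔ (k x : V) ∈ T'.Y₂.carrier) ∧
    ∀ x : T.D, T.G.q x = T'.G.q (k x) := by
  obtain ⟨k, hα, hρ⟩ := T.disj.exists_iso T'.disj (T.α.trans T'.α.symm) (T.ρ.trans T'.ρ.symm)
  have cover : ∀ x : T.D, (x : V) ∈ T.A'.carrier ∨ (x : V) ∈ T.R'.carrier := fun x =>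
    T.disj.union.ge x.2
  have hα' : ∀ y : T.A', T'.α ((T.α.trans T'.α.symm) y) = T.α y := fun y =>
    T'.α.apply_symm_apply _
  have hρ' : ∀ y : T.R', T'.ρ ((T.ρ.trans T'.ρ.symm) y) = T.ρ y := fun y =>
    T'.ρ.apply_symm_apply _
  refine ⟨k, hα, hρ, fun x => ?_, fun x => ?_, fun x => ?_⟩
  · rcases cover x with hx | hx
    · rw [hα x ⟨x, hx⟩ rfl, T'.mem_Y₁_iff, hα', ← T.mem_Y₁_iff]
    -- On `R'` both sides are false: `Y₁` lies in `A'` in either presentation, and `k` sends `R'` to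
    -- `R'`.
    · rw [hρ x ⟨x, hx⟩ rfl]
      exact iff_of_false (fun h => disjoint_left.1 T.disj.disjoint (T.subset_A' h) hx)
        (fun h => disjoint_left.1 T'.disj.disjoint (T'.subset_A' h) (Subtype.prop _))
  · rcases cover x with hx | hx
    · rw [hα x ⟨x, hx⟩ rfl]
      exact iff_of_false (fun h => disjoint_left.1 T.disj.disjoint hx (T.subset_R' h))
        (fun h => disjoint_left.1 T'.disj.disjoint (Subtype.prop _) (T'.subset_R' h))
    · rw [hρ x ⟨x, hx⟩ rfl, T'.mem_Y₂_iff, hρ', ← T.mem_Y₂_iff]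
  · apply Subtype.ext
    rcases cover x with hx | hx
    · rw [T.q_eq_α x ⟨x, hx⟩ rfl, T'.q_eq_α _ _ (hα x ⟨x, hx⟩ rfl), hα']
    · rw [T.q_eq_ρ x ⟨x, hx⟩ rfl, T'.q_eq_ρ _ _ (hρ x ⟨x, hx⟩ rfl), hρ']

end TwoPiece

/-! ### Images of submanifolds -/

/-- The image of `B ⊆ X` under a homeomorphism defined on `X`. -/
def PLHomeo.imageSet {X Y : Set V} (f : PLHomeo X Y) (B : Set V) : Set V :=
  {y | ∃ hy : y ∈ Y, (f.symm ⟨y, hy⟩ : V) ∈ B}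

theorem PLHomeo.imageSet_subset {X Y : Set V} (f : PLHomeo X Y) (B : Set V) :
    f.imageSet B ⊆ Y := fun _ h => h.1

theorem PLHomeo.mem_imageSet {X Y : Set V} (f : PLHomeo X Y) (B : Set V) (x : X) :
    (x : V) ∈ B ↔ (f x : V) ∈ f.imageSet B := by
  constructor
  · intro hx
    exact ⟨(f x).2, by rw [f.symm_apply_apply]; exact hx⟩
  · rintro ⟨_, h⟩
    rwa [f.symm_apply_apply] at h

/-- A homeomorphism, restricted to a subset and its image. -/
def PLHomeo.restrictImage {X Y : Set V} (f : PLHomeo X Y) {B : Set V} (hB : B ⊆ X) :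
    PLHomeo B (f.imageSet B) :=
  f.restrict hB (f.imageSet_subset B) (f.mem_imageSet B)

/-- The image is a preimage under the continuous inverse; the rest translates between neighbourhoods
in a subtype and `𝓝[X]`. -/
theorem PLHomeo.imageSet_mem_nhdsWithin {X Y : Set V} (f : PLHomeo X Y) {Q : Set V} (x : X)
    (hQX : Q ⊆ X) (hQ : Q ∈ 𝓝[X] (x : V)) : f.imageSet Q ∈ 𝓝[Y] (f x : V) := by
  have h2 : (Subtype.val ⁻¹' Q : Set X) ∈ 𝓝 x := by
    rw [mem_nhds_subtype_iff_nhdsWithin]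
    exact Filter.mem_of_superset hQ (fun z hz => ⟨⟨z, hQX hz⟩, hz, rfl⟩)
  have h3 : (fun y : Y => f.symm y) ⁻¹' (Subtype.val ⁻¹' Q) ∈ 𝓝 (f x) := by
    have hc : ContinuousAt (fun y : Y => f.symm y) (f x) := f.continuous_invFun.continuousAt
    exact hc.preimage_mem_nhds (by rw [f.symm_apply_apply]; exact h2)
  rw [mem_nhds_subtype_iff_nhdsWithin] at h3
  refine Filter.mem_of_superset h3 ?_
  rintro _ ⟨y, hy, rfl⟩
  exact ⟨y.2, hy⟩

theorem IsBall.map {d : ℤ} {Q Q' : Set V} (f : PLHomeo Q Q') (h : IsBall d Q) : IsBall d Q' := by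
  obtain ⟨m, hm, ⟨φ⟩⟩ := h
  exact ⟨m, hm, ⟨f.symm.trans φ⟩⟩

theorem IsLocallyBall.map {d : ℤ} {X Y : Set V} (f : PLHomeo X Y) (h : IsLocallyBall d X) :
    IsLocallyBall d Y := by
  intro y hy
  obtain ⟨x, rfl⟩ : ∃ x : X, (f x : V) = y := ⟨f.symm ⟨y, hy⟩, by rw [f.apply_symm_apply]⟩
  obtain ⟨Q, hQX, hQ, hb⟩ := h x x.2
  exact ⟨f.imageSet Q, f.imageSet_subset Q, f.imageSet_mem_nhdsWithin x hQX hQ,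
    hb.map (f.restrictImage hQX)⟩

/-- Compactness passes through the homeomorphism with `B`. For the cells, the image is viewed as the
preimage of `B` under the PL inverse, since preimages of cells under affine maps are cells whereas
images would need elimination of variables. -/
theorem IsPolyhedron.imageSet {X Y B : Set V} (f : PLHomeo X Y) (hY : IsPolyhedron Y)
    (hB : IsPolyhedron B) (hBX : B ⊆ X) : IsPolyhedron (f.imageSet B) := by
  constructor
  · have := isCompact_iff_compactSpace.1 hB.1
    have := (f.restrictImage hBX).toHomeomorph.compactSpace
    exact isCompact_iff_compactSpace.2 this
  · obtain ⟨ι, _, K, a, hK, hKc, ha⟩ := f.isPL_inv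
    obtain ⟨_, P, hP, hPc, rfl⟩ := hY
    obtain ⟨_, Q, hQ, hQc, rfl⟩ := hB
    -- A cell of linearity of the inverse, cut down to a cell of `Y` (where the affine map does
    -- describe the inverse) and to the preimage of a cell of `B`.
    refine ⟨range (fun t : ι × P × Q => (K t.1 ∩ t.2.1) ∩ a t.1 ⁻¹' t.2.2), ?_, ?_, ?_⟩
    · have := hP.to_subtype
      have := hQ.to_subtype
      exact finite_range _
    · rintro _ ⟨⟨i, p, q⟩, rfl⟩
      exact ((hK i).inter (hPc _ p.2)).inter_preimage (hQc _ q.2) _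
    · ext y
      constructor
      · rintro ⟨hy, q, hq, hyq⟩
        obtain ⟨i, hi⟩ := hKc ⟨y, hy⟩
        obtain ⟨p, hp, hyp⟩ := hy
        refine ⟨_, ⟨⟨i, ⟨p, hp⟩, ⟨q, hq⟩⟩, rfl⟩, ⟨hi, hyp⟩, ?_⟩
        have := ha i ⟨y, ⟨p, hp, hyp⟩⟩ hi
        rw [mem_preimage, ← this]
        exact hyq
      · rintro ⟨_, ⟨⟨i, p, q⟩, rfl⟩, ⟨hi, hyp⟩, hyq⟩
        have hy : y ∈ ⋃₀ P := ⟨_, p.2, hyp⟩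
        refine ⟨hy, _, q.2, ?_⟩
        have := ha i ⟨y, hy⟩ hi
        rw [mem_preimage, ← this] at hyq
        exact hyq

/-- The boundary is intrinsic: apply `mem_boundarySet_map` to the restriction of `f` to `B`. -/
theorem boundarySet_imageSet {d : ℤ} {X Y B : Set V} (f : PLHomeo X Y) (hB : B ⊆ X) :
    boundarySet d (f.imageSet B) = f.imageSet (boundarySet d B) := by
  ext y
  constructor
  · intro h
    obtain ⟨hy, hyB⟩ := h.1
    refine ⟨hy, ?_⟩
    rw [← show ((f.restrictImage hB) ⟨_, hyB⟩ : V) = y from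
      congrArg Subtype.val (f.apply_symm_apply ⟨y, hy⟩), ← mem_boundarySet_map] at h
    exact h
  · rintro ⟨hy, hyB⟩
    have h := (mem_boundarySet_map (f.restrictImage hB) ⟨_, hyB.1⟩).1 hyB
    rwa [show ((f.restrictImage hB) ⟨_, hyB.1⟩ : V) = y from
      congrArg Subtype.val (f.apply_symm_apply ⟨y, hy⟩)] at h

/-- The image of a submanifold under a homeomorphism. -/
def PLMan.image {d : ℤ} (B : PLMan d) {X Y : PLMan d} (f : X.Iso Y) (hB : B.carrier ⊆ X.carrier) :
    PLMan d where
  carrier := f.imageSet B.carrier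
  isPolyhedron := Y.isPolyhedron.imageSet f B.isPolyhedron hB
  locallyBall := B.locallyBall.map (f.restrictImage hB)
  boundary_isPolyhedron := by
    rw [boundarySet_imageSet f hB]
    exact Y.isPolyhedron.imageSet f B.boundary_isPolyhedron ((boundarySet_subset _ _).trans hB)
  boundary_locallyBall := by
    rw [boundarySet_imageSet f hB]
    exact B.boundary_locallyBall.map (f.restrictImage ((boundarySet_subset _ _).trans hB))
  boundary_boundary := by
    rw [boundarySet_imageSet f hB,
      boundarySet_imageSet f ((boundarySet_subset _ _).trans hB), B.boundary_boundary]
    ext y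
    simp [PLHomeo.imageSet]

/-- The homeomorphism of a submanifold with its image. -/
def PLMan.toImage {d : ℤ} (B : PLMan d) {X Y : PLMan d} (f : X.Iso Y)
    (hB : B.carrier ⊆ X.carrier) : B.Iso (B.image f hB) :=
  f.restrictImage hB

/-- Continuity of `f` gives one inclusion; the same inclusion for `f.symm` gives the other, once
closedness of `Y` keeps the closure inside the domain of `f.symm`. -/
theorem PLHomeo.imageSet_closure_diff {X Y : Set V} (f : PLHomeo X Y) (hX : IsClosed X)
    (hY : IsClosed Y) (B : Set V) :
    f.imageSet (closure (X \ B)) = closure (Y \ f.imageSet B) := by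
  have half : ∀ {X Y : Set V} (f : PLHomeo X Y) (_ : IsClosed X) (B : Set V),
      f.imageSet (closure (X \ B)) ⊆ closure (Y \ f.imageSet B) := by
    rintro X Y f hX B y ⟨hy, h⟩
    obtain ⟨x, rfl⟩ : ∃ x : X, (f x : V) = y := ⟨f.symm ⟨y, hy⟩, by rw [f.apply_symm_apply]⟩
    rw [Subtype.coe_eta, f.symm_apply_apply] at h
    have hx : x ∈ closure (Subtype.val ⁻¹' (X \ B) : Set X) := by
      rw [closure_subtype]
      convert h
      ext z
      simp
    have := image_closure_subset_closure_image
      (continuous_subtype_val.comp f.continuous_toFun) (mem_image_of_mem _ hx)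
    refine closure_mono ?_ this
    rintro _ ⟨z, hz, rfl⟩
    exact ⟨(f z).2, fun h => hz.2 ((f.mem_imageSet B z).2 h)⟩
  refine (half f hX B).antisymm fun y hy => ?_
  have hyY : y ∈ Y := closure_minimal sdiff_subset hY hy
  refine ⟨hyY, ?_⟩
  have h := half f.symm hY (f.imageSet B) ((f.symm.mem_imageSet _ ⟨y, hyY⟩).1 hy)
  refine closure_mono ?_ h
  rintro x ⟨hx, hx'⟩
  refine ⟨hx, fun hxB => hx' ?_⟩
  have h := (f.symm.mem_imageSet _ (f ⟨x, hx⟩)).1 ((f.mem_imageSet B ⟨x, hx⟩).1 hxB)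
  rwa [f.symm_apply_apply] at h

/-- Changing the result of a gluing by a homeomorphism. -/
def Gluing.mapTarget {d : ℤ} {X Z Z' : PLMan d} {Y₁ Y₂ W : PLMan (d - 1)} (G : Gluing X Z Y₁ Y₂ W)
    (f : Z.Iso Z') : Gluing X Z' Y₁ Y₂ W where
  h := G.h
  q x := f (G.q x)
  subset₁ := G.subset₁
  subset₂ := G.subset₂
  disjoint := G.disjoint
  rest := G.rest
  corner := G.corner
  bdry_rest := G.bdry_rest
  continuous_q := f.continuous_toFun.comp G.continuous_q
  isPL_q := f.isPL.comp G.isPL_q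
  surjective_q := f.toHomeomorph.surjective.comp G.surjective_q
  q_eq_iff x x' := f.toHomeomorph.injective.eq_iff.trans (G.q_eq_iff x x')

/-- The image of a presentation of `X` as a union of two pieces. -/
def TwoPiece.image {d : ℤ} {X X' A R : PLMan d} (T : TwoPiece X A R) (f : X.Iso X')
    (hA : A.carrier ⊆ X.carrier) (hR : R.carrier ⊆ X.carrier) :
    TwoPiece X' (A.image f hA) (R.image f hR) where
  D := T.D
  A' := T.A'
  R' := T.R'
  disj := T.disj
  α := T.α.trans (A.toImage f hA)
  ρ := T.ρ.trans (R.toImage f hR)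
  Y₁ := T.Y₁
  Y₂ := T.Y₂
  W := T.W
  G := T.G.mapTarget f
  subset_A' := T.subset_A'
  subset_R' := T.subset_R'
  q_eq_α x y h := by
    change (f (T.G.q x) : V) = f ⟨T.α y, _⟩
    congr 2
    exact Subtype.ext (T.q_eq_α x y h)
  q_eq_ρ x y h := by
    change (f (T.G.q x) : V) = f ⟨T.ρ y, _⟩
    congr 2
    exact Subtype.ext (T.q_eq_ρ x y h)

theorem EmbeddedBall.complement_subset {n : ℕ} {X : PLMan (n : ℤ)} (β : EmbeddedBall X) :
    β.R.carrier ⊆ X.carrier := by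
  rw [β.complement]
  exact closure_minimal sdiff_subset X.isPolyhedron.1.isClosed

/-- The image of a blob under a homeomorphism. -/
def EmbeddedBall.image {n : ℕ} {X X' : PLMan (n : ℤ)} (β : EmbeddedBall X) (f : X.Iso X') :
    EmbeddedBall X' where
  B := β.B.image f β.subset
  R := β.R.image f β.complement_subset
  isBall := β.isBall.map (β.B.toImage f β.subset)
  subset := f.imageSet_subset _
  complement := by
    change f.imageSet _ = closure (X'.carrier \ f.imageSet _)
    rw [β.complement]
    exact f.imageSet_closure_diff X.isPolyhedron.1.isClosed X'.isPolyhedron.1.isClosed _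
  glue := β.glue.map fun T => T.image f β.subset β.complement_subset

/-! ### Gluing of fields -/

universe u v

namespace SystemOfFields

variable {K : Type u} [Field K] {n : ℕ} (F : SystemOfFields.{u, v} K n)

/-- The case of `gl_assoc` in which a one-step gluing sequence is compared with itself. -/
theorem gl_unique {d : ℤ} (hd : d ≤ n) {X Z : PLMan d} {Y₁ Y₂ W : PLMan (d - 1)}
    (G : Gluing X Z Y₁ Y₂ W) {x : F.C X} {z z' : F.C Z} (h : F.Gl G x z) (h' : F.Gl G x z') :
    z = z' :=
  F.gl_assoc hd (.cons G (.nil Z)) (.cons G (.nil Z)) rfl x z z' ⟨z, h, rfl⟩ ⟨z', h', rfl⟩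

theorem map_symm_map {d : ℤ} (hd : d ≤ n) {A A' B : PLMan d} (f : A'.Iso A) (g : A.Iso B)
    (x : F.C A) : F.map (f.trans g).symm (F.map g x) = F.map f.symm x := by
  rw [← F.map_trans hd]
  congr 1
  apply PLHomeo.ext_fun
  intro a
  exact congrArg f.symm (g.symm_apply_apply a)

theorem map_trans_symm {d : ℤ} (hd : d ≤ n) {A A₁ A₂ : PLMan d} (f : A₁.Iso A) (g : A₂.Iso A)
    (x : F.C A) : F.map (f.trans g.symm) (F.map f.symm x) = F.map g.symm x := by
  rw [← F.map_trans hd]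
  congr 1
  apply PLHomeo.ext_fun
  intro a
  exact congrArg g.symm (f.apply_symm_apply a)

/-- The glued field `u • r` does not depend on the presentation of `X` as a union. -/
theorem bullet_unique {d : ℤ} (hd : d ≤ n) {X A R : PLMan d} {u : F.C A} {r : F.C R}
    {z z' : F.C X} (h : F.Bullet u r z) (h' : F.Bullet u r z') : z = z' := by
  obtain ⟨T, hT⟩ := h
  obtain ⟨T', hT'⟩ := h'
  obtain ⟨k, hα, hρ, h₁, h₂, hq⟩ := T.exists_iso T'
  -- Transport along `k` upstairs and the identity on `X` turns the first gluing into one along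
  -- `T'.G` of the same pair of fields, so uniqueness for a single gluing applies.
  have := F.gl_map hd T.G T'.G k (PLHomeo.refl X.carrier) h₁ h₂ hq _ _ hT
  rw [F.map_refl hd, F.jux_map hd T.disj T'.disj k _ _ hα hρ, F.map_trans_symm hd,
    F.map_trans_symm hd] at this
  exact F.gl_unique hd _ this hT'

/-- Only the target of the gluing is moved: `D` and the fields on it stay fixed, because the new
parametrisations of the pieces are the old ones followed by the restrictions of `f`. -/
theorem bullet_image {d : ℤ} (hd : d ≤ n) {X X' A R : PLMan d} (f : X.Iso X')
    (hA : A.carrier ⊆ X.carrier) (hR : R.carrier ⊆ X.carrier) {u : F.C A} {r : F.C R} {z : F.C X}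
    (h : F.Bullet u r z) :
    F.Bullet (F.map (A.toImage f hA) u) (F.map (R.toImage f hR) r) (F.map f z) := by
  obtain ⟨T, hT⟩ := h
  refine ⟨T.image f hA hR, ?_⟩
  have := F.gl_map hd T.G (T.G.mapTarget f) (PLHomeo.refl T.D.carrier) f
    (fun _ => Iff.rfl) (fun _ => Iff.rfl) (fun _ => rfl) _ _ hT
  rw [F.map_refl hd] at this
  have e₁ : F.map (T.image f hA hR).α.symm (F.map (A.toImage f hA) u) = F.map T.α.symm u :=
    F.map_symm_map hd T.α _ u
  have e₂ : F.map (T.image f hA hR).ρ.symm (F.map (R.toImage f hR) r) = F.map T.ρ.symm r :=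
    F.map_symm_map hd T.ρ _ r
  rw [e₁, e₂]
  exact this

/-- If one pair of fields with boundary conditions `b` and `s` can be glued, then gluing is defined
on all such pairs and bilinear. -/
theorem exists_bilinear_bullet {X A R : PLMan (n : ℤ)} {c : F.C X.bdry} {b : F.C A.bdry}
    {s : F.C R.bdry} (u : F.Fld b) (r : F.Fld s) (z : F.Fld c) (h : F.Bullet u.1 r.1 z.1) :
    ∃ L : F.Fld b →ₗ[K] F.Fld s →ₗ[K] F.Fld c, ∀ u r, F.Bullet u.1 r.1 (L u r).1 := by
  obtain ⟨T, hT⟩ := h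
  obtain ⟨Lα, hα⟩ := F.map_linear T.α.symm b
  obtain ⟨Lρ, hρ⟩ := F.map_linear T.ρ.symm s
  obtain ⟨J, hJ, -⟩ := F.jux_tensor T.disj (F.map T.α.symm.bdry b) (F.map T.ρ.symm.bdry s)
  -- By `gl_domain` gluability is a condition on the boundary field only. That field is determined
  -- by `b` and `s`, so the matching found for one pair serves all pairs.
  obtain ⟨w, hw⟩ := (F.gl_domain le_rfl T.G _).1 ⟨_, hT⟩
  have e : ∀ u r, (J (Lα u) (Lρ r)).1 =
      F.jux T.disj (F.map T.α.symm u.1) (F.map T.ρ.symm r.1) := fun u r => by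
    rw [hJ, hα, hρ]
  rw [← e, (J (Lα u) (Lρ r)).2] at hw
  obtain ⟨c', L, hL⟩ := F.gl_linear T.G _ w hw
  have hz : (L (J (Lα u) (Lρ r))).1 = z.1 :=
    F.gl_unique le_rfl T.G (hL _) (by rw [e]; exact hT)
  -- `gl_linear` leaves the target boundary condition unspecified; the given glued field `z`, whose
  -- restriction is `c`, pins it down.
  obtain rfl : c' = c := by rw [← (L (J (Lα u) (Lρ r))).2, hz, z.2]
  refine ⟨(J.compl₁₂ Lα Lρ).compr₂ L, fun u r => ⟨T, ?_⟩⟩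
  rw [← e]
  exact hL _

end SystemOfFields

/-! ### The image of the differential and the action of homeomorphisms -/

namespace LocalRelation

variable {K : Type u} [Field K] {n : ℕ} {F : SystemOfFields.{u, v} K n} (𝒰 : LocalRelation F)

theorem BlobBC.bullet_spec {X : PLMan (n : ℤ)} {c : F.C X.bdry} {β : EmbeddedBall X}
    (p : BlobBC F c β) (u : F.Fld p.b) (r : F.Fld p.s) : F.Bullet u.1 r.1 (p.bullet u r).1 :=
  p.exists_bullet.choose_spec u r

open Classical in
theorem boundary_lof {X : PLMan (n : ℤ)} (c : F.C X.bdry) (β : EmbeddedBall X) (p : BlobBC F c β)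
    (t : (𝒰.U β.isBall p.b) ⊗[K] F.Fld p.s) :
    𝒰.boundary c (DirectSum.lof K _ (fun β => DirectSum (BlobBC F c β) fun p =>
      (𝒰.U β.isBall p.b) ⊗[K] F.Fld p.s) β (DirectSum.lof K _ (fun p : BlobBC F c β =>
      (𝒰.U β.isBall p.b) ⊗[K] F.Fld p.s) p t)) =
    TensorProduct.lift (p.bullet.comp (𝒰.U β.isBall p.b).subtype) t := by
  unfold boundary
  rw [DirectSum.toModule_lof, DirectSum.toModule_lof]

/-- The image of the differential is the space of local relations. -/
theorem range_boundary {X : PLMan (n : ℤ)} (c : F.C X.bdry) :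
    LinearMap.range (𝒰.boundary c) = 𝒰.relations c := by
  classical
  apply le_antisymm
  · rintro _ ⟨t, rfl⟩
    induction t using DirectSum.induction_on with
    | zero => rw [map_zero]; exact zero_mem _
    | add t t' h h' => rw [map_add]; exact add_mem h h'
    | of β t =>
      induction t using DirectSum.induction_on with
      | zero => rw [map_zero, map_zero]; exact zero_mem _
      | add t t' h h' => rw [map_add, map_add]; exact add_mem h h'
      | of p t =>
        have h := 𝒰.boundary_lof c β p t
        rw [DirectSum.lof_eq_of, DirectSum.lof_eq_of] at h
        rw [h]
        clear h
        induction t using TensorProduct.induction_on with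
        | zero => rw [map_zero]; exact zero_mem _
        | add t t' h h' =>
          rw [map_add]
          exact add_mem h h'
        | tmul u r =>
          exact Submodule.subset_span ⟨β, p.b, u.1, r.1, u.2, p.bullet_spec u.1 r⟩
  · refine Submodule.span_le.2 ?_
    rintro z ⟨β, b, u, r, hu, h⟩
    -- The complement field in a relation comes with no prescribed boundary condition; its own
    -- restriction selects the summand of `B₁`.
    let r' : F.Fld (F.bd r) := ⟨r, rfl⟩
    let p : BlobBC F c β := ⟨b, F.bd r, F.exists_bilinear_bullet u r' z h⟩
    refine ⟨_, (𝒰.boundary_lof c β p ((⟨u, hu⟩ : 𝒰.U β.isBall b) ⊗ₜ r')).trans ?_⟩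
    -- The map `p.bullet` is a chosen one, possibly using another presentation of `X` than `h`;
    -- uniqueness shows that its value is still `z`.
    exact Subtype.ext (F.bullet_unique le_rfl (p.bullet_spec u r') h)

/-- Homeomorphisms preserve the local relations. -/
theorem mapFld_mem_relations {X X' : PLMan (n : ℤ)} (f : X.Iso X') {c : F.C X.bdry}
    {x : F.Fld c} (hx : x ∈ 𝒰.relations c) : F.mapFld f c x ∈ 𝒰.relations (F.map f.bdry c) := by
  -- `mapFld` is a bare function; `L` is the linear map with the same values, so it suffices to
  -- treat the generators of the span.
  obtain ⟨L, hL⟩ := F.map_linear f c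
  have e : ∀ x, L x = F.mapFld f c x := fun x => Subtype.ext (hL x)
  rw [← e]
  suffices h : 𝒰.relations c ≤ (𝒰.relations (F.map f.bdry c)).comap L from h hx
  refine Submodule.span_le.2 ?_
  rintro z ⟨β, b, u, r, hu, h⟩
  change L z ∈ 𝒰.relations (F.map f.bdry c)
  rw [e]
  refine Submodule.subset_span ⟨β.image f, _, F.mapFld (β.B.toImage f β.subset) b u,
    F.map (β.R.toImage f β.complement_subset) r, ?_,
    F.bullet_image le_rfl f β.subset β.complement_subset h⟩
  have := 𝒰.functorial β.isBall (β.image f).isBall (β.B.toImage f β.subset) b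
  exact this.subset ⟨u, hu, rfl⟩

end LocalRelation

end BlobComplex

/-! ### The natural isomorphism -/

theorem proposition3p1p1 {K : Type*} [Field K] {n : ℕ} {F : SystemOfFields K n}
    (U : LocalRelation F) :
    ∃ Φ : ∀ (X : PLMan (n : ℤ)) (c : F.C X.bdry), U.H₀ c ≃ₗ[K] U.Skein c,
      (∀ X c (x : F.Fld c), Φ X c (Submodule.Quotient.mk x) = Submodule.Quotient.mk x) ∧
      ∀ (X X' : PLMan (n : ℤ)) (f : X.Iso X') (c : F.C X.bdry),
        ∃ (fH : U.H₀ c →ₗ[K] U.H₀ (F.map f.bdry c))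
          (fA : U.Skein c →ₗ[K] U.Skein (F.map f.bdry c)),
          (∀ x, fH (Submodule.Quotient.mk x) = Submodule.Quotient.mk (F.mapFld f c x)) ∧
          (∀ x, fA (Submodule.Quotient.mk x) = Submodule.Quotient.mk (F.mapFld f c x)) ∧
          ∀ y, Φ X' (F.map f.bdry c) (fH y) = fA (Φ X c y) := by
  refine ⟨fun X c => Submodule.quotEquivOfEq _ _ (U.range_boundary c), fun X c x => rfl,
    fun X X' f c => ?_⟩
  obtain ⟨L, hL⟩ := F.map_linear f c
  have e : ∀ x, L x = F.mapFld f c x := fun x => Subtype.ext (hL x)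
  have hA : U.relations c ≤ (U.relations (F.map f.bdry c)).comap L := fun x hx => by
    rw [Submodule.mem_comap, e]
    exact U.mapFld_mem_relations f hx
  have hH : LinearMap.range (U.boundary c) ≤
      (LinearMap.range (U.boundary (F.map f.bdry c))).comap L := by
    -- With both images rewritten as spaces of relations, this is `hA`.
    rwa [U.range_boundary, U.range_boundary]
  refine ⟨Submodule.mapQ _ _ L hH, Submodule.mapQ _ _ L hA, fun x => ?_, fun x => ?_, fun y => ?_⟩
  · rw [Submodule.mapQ_apply, e]
  · rw [Submodule.mapQ_apply, e]
  · obtain ⟨x, rfl⟩ := Submodule.Quotient.mk_surjective _ y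
    -- All four maps act on representatives: both composites send the class of `x` to the class of
    -- `L x`.
    rfl
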